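/- All graphs are finite and simple. A *2-fold cover* of a graph $G$ is a pair $(L,H)$, where $H$ is a graph and the sets $L(v)$, $v\in V(G)$, partition $V(H)$, such that for each $v$ the set $L(v)=\{p(v),r(v)\}$ consists of two adjacent nodes (a *poor* node $p(v)$ and a *rich* node $r(v)$), edges of $H$ between different sets $L(u),L(v)$ exist only if $uv\in E(G)$, and for every $uv\in E(G)$ the edges of $H$ between $L(u)$ and $L(v)$ form a (possibly empty) matching. For integers $0\le i\le j$, an *$(i,j)$-defective coloring* of the cover is an injective map $\varphi:V(G)\to V(H)$ with $\varphi(v)\in L(v)$ for all $v$ such that, in the subgraph $H_\varphi$ of $H$ induced by $\varphi(V(G))$, every poor node has degree at most $i$ and every rich node has degree at most $j$. The graph $G$ is *$(i,j)$-defective-DP-colorable* if every 2-fold cover of $G$, with every choice of the poor and rich nodes, has such a coloring; $G$ is *$(i,j)$-defective-DP-critical* if it is not $(i,j)$-defective-DP-colorable but every proper subgraph of it is. Let $g_{DP}(i,j,n)$ be the minimum number of edges in an $n$-vertex $(i,j)$-defective-DP-critical simple graph ($+\infty$ if there is none). **Theorem.** Let $i\in\{1,2\}$ and let $j\ge 2i$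 be an integer. Then every $n$-vertex $(i,j)$-defective-DP-critical simple graph has at least $$\frac{(2i+1)n+j-i+1}{i+1}$$ edges; that is, $$g_{DP}(i,j,n)\ \ge\ \frac{(2i+1)n+j-i+1}{i+1}\qquad\text{for all } n.$$ This is sharp for each such pair $(i,j)$ for infinitely many $n$: for each such $(i,j)$ there are infinitely many $n$ for which equality holds. -/

import Mathlib

universe u

/-- A cover `(L, H)` of a simple graph `G`: the lists `L v` partition the nodes of the cover graph
`H`, each list induces a complete graph, edges between different lists occur only over edges of
`G`, and over each edge of `G` they form a (possibly empty, possibly non-perfect) matching. -/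
structure DPCover {V : Type u} (G : SimpleGraph V) where
  Node : Type u
  H : SimpleGraph Node
  L : V → Set Node
  partition : ∀ x : Node, ∃! v : V, x ∈ L v
  complete : ∀ (v : V) (x y : Node), x ∈ L v → y ∈ L v → x ≠ y → H.Adj x y
  edges_over : ∀ (v w : V) (x y : Node), x ∈ L v → y ∈ L w → H.Adj x y → v = w ∨ G.Adj v w
  matching : ∀ (v w : V) (x y z : Node), G.Adj v w → x ∈ L v → y ∈ L w → z ∈ L w →
    H.Adj x y → H.Adj x z → y = z

namespace DPCover

variable {V : Type u} {G : SimpleGraph V}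

/-- Every list has exactly two nodes. -/
def IsTwoFold (C : DPCover G) : Prop := ∀ v : V, (C.L v).encard = 2

/-- `p v` is the poor node and `r v` is the rich node over `v`. In a 2-fold cover this forces
`p v ≠ r v`. -/
def IsPoorRich (C : DPCover G) (p r : V → C.Node) : Prop := ∀ v : V, C.L v = {p v, r v}

/-- An `(L, H)`-map: an injection picking a node from every list. -/
def IsMap (C : DPCover G) (φ : V → C.Node) : Prop :=
  Function.Injective φ ∧ ∀ v : V, φ v ∈ C.L v

/-- The cover graph `H_φ` induced by the image of `φ`. -/
def inducedGraph (C : DPCover G) (φ : V → C.Node) : SimpleGraph (Set.range φ) :=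
  C.H.induce (Set.range φ)

/-- The degree of the node `x` in `H_φ`. -/
noncomputable def inducedDegree (C : DPCover G) (φ : V → C.Node) (x : Set.range φ) : ℕ∞ :=
  ((C.inducedGraph φ).neighborSet x).encard

/-- `φ` is an `(i, j)`-defective coloring of the cover with poor nodes `p` and rich nodes `r`. -/
def IsColoring (C : DPCover G) (p r : V → C.Node) (i j : ℕ) (φ : V → C.Node) : Prop :=
  C.IsMap φ ∧
  (∀ x : Set.range φ, (x : C.Node) ∈ Set.range p → C.inducedDegree φ x ≤ (i : ℕ∞)) ∧
  (∀ x : Set.range φ, (x : C.Node) ∈ Set.range r → C.inducedDegree φ x ≤ (j : ℕ∞))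

end DPCover

/-- `G` is `(i, j)`-defective-DP-colorable: every 2-fold cover, with every choice of which node of
each list is poor and which is rich, has an `(i, j)`-defective coloring. -/
def IsDPColorable {V : Type u} (G : SimpleGraph V) (i j : ℕ) : Prop :=
  ∀ (C : DPCover G) (p r : V → C.Node), C.IsTwoFold → C.IsPoorRich p r →
    ∃ φ : V → C.Node, C.IsColoring p r i j φ

/-- `G` is `(i, j)`-defective-DP-critical: it is not colorable but every proper subgraph is. -/
def IsDPCritical {V : Type u} (G : SimpleGraph V) (i j : ℕ) : Prop :=
  ¬ IsDPColorable G i j ∧ ∀ G' : G.Subgraph, G' ≠ ⊤ → IsDPColorable G'.coe i j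

/-- The minimum number of edges of an `n`-vertex `(i, j)`-defective-DP-critical simple graph
(`⊤` if there is no such graph). -/
noncomputable def gDP (i j n : ℕ) : ℕ∞ :=
  ⨅ (G : SimpleGraph (Fin n)) (_ : IsDPCritical G i j), G.edgeSet.encard

/-- The number `((2i+1)n + j - i + 1)/(i+1)`. -/
noncomputable def dpBound (i j n : ℕ) : ℝ :=
  ((2 * (i : ℝ) + 1) * n + j - i + 1) / ((i : ℝ) + 1)

/-!
Write `M = j - i`. A 2-fold cover is encoded by a signed graph: after completing its matchings,
each edge either joins equal nodes (poor to poor, rich to rich) or different ones. A colouring of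
a set `A` respects *capacities* if each vertex `v` of colour `b` has at most `cap v b` conflicts,
with `cap v false ≤ i` and `cap v true ≤ i + M`. Capacities are allowed to vary so that conflicts
with vertices coloured elsewhere can be paid for in advance. The *potential* of a vertex set is
the sum of `cap v false + cap v true + 1 - M` over its vertices, minus `i + 1` for each edge
inside; for the original capacities it is `(2 * i + 1) * |T| - (i + 1) * e(T)`.

The heart of the proof is `SignedGraph.sparseColorable`: if every nonempty subset of `A` has
potential at least `-M`, then `A` can be coloured. The lower bound follows
(`IsDPCritical.edge_bound`): a critical graph carries an uncolourable signed graph, and if the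
whole vertex set had potential at least `-M`, then a nonempty set of least potential could be
coloured, by criticality or by sparsity, and its colouring would extend to all vertices.

Extension is the first tool. When a set is coloured, each outside vertex with one neighbour in it
has one forbidden colour, and `SparseColorable.colorableAvoiding` colours a set with forbidden
colours as long as its subsets have nonnegative potential after a charge of `i + 1` for each
forbidden colour. It colours one vertex with a forbidden colour first; its neighbours either get a
forbidden colour or lose one unit of capacity, and the uncrossing lemma `exists_selection` finds a
choice that keeps the potentials nonnegative.

Suppose now that `A` is a smallest counterexample (`SignedGraph.Obstruction`). Its proper nonempty
subsets then have potential at least `1 - M`, and at least `2 - M` if they miss two vertices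
(`pot_ge_two`). A *link* is a vertex of weight `2 * i + 1` and degree two; the other vertices form
the *core*. Links are pairwise nonadjacent. Deleting a core vertex together with its links
(`peel`) shows that every core vertex with `m` neighbours in the core and `n` links has
nonnegative *surplus* `(i + 1) * m + n - 2 * weight` (`surplus_nonneg`; this is where `i ≤ 2` is
needed). The sum of the surpluses is minus twice the potential of `A`, so it is at most `2 * M`.
Take a colouring of the core that minimizes twice the number of conflicts minus twice the
capacities in use, plus the number of links whose neighbours exclude different colours. Such a
split link has exactly one conflict, at an end of our choice. Changing one colour at a time bounds
the excess of each core vertex by its surplus, and the bound on the sum of surpluses is what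
Hall's theorem needs to give each split link an end with room for its conflict
(`not_obstruction`).

For sharpness, `j + 1` caterpillars of rich type and `i + 1` of poor type are attached to a root.
If the root has colour `c`, then it has a conflict in every caterpillar of type `c`, which is one
too many. All proper subgraphs are sparse because the cost `i + 1` of each edge can be shared by
its ends such that every vertex pays `2 * i + 1` and the root pays `i + j + 2`
(`SignedGraph.Payment`), so that they are colourable by `sparseColorable`. The same shares count
the edges.
-/

set_option linter.unusedSectionVars false

/-! ### Signed graphs, potentials and uncrossing -/

/-- A signed graph: `sign x y` is `none` if `x` and `y` are not adjacent, and otherwise it is the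
value of `xor (φ x) (φ y)` for which a colouring `φ` has a conflict on the edge `xy`. The colour
`false` stands for the poor node and `true` for the rich node, so a signed graph encodes a 2-fold
cover with perfect matchings: an edge of sign `false` joins poor to poor and rich to rich, an edge
of sign `true` joins poor to rich. -/
structure SignedGraph (V : Type u) where
  sign : V → V → Option Bool
  symm : ∀ x y, sign x y = sign y x
  loopless : ∀ x, sign x x = none

namespace SignedGraph

variable {V : Type u} (G : SignedGraph V)

/-- The adjacency indicator of a signed graph, as an integer. -/
def ind (x y : V) : ℤ := if (G.sign x y).isSome then 1 else 0

/-- The indicator of the event that the edge `xy` is a conflict under the colouring `φ`. -/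
def conf (φ : V → Bool) (x y : V) : ℤ := if G.sign x y = some (xor (φ x) (φ y)) then 1 else 0

/-- The number of neighbours of `v` in `T`. -/
def nb (v : V) (T : Finset V) : ℤ := ∑ y ∈ T, G.ind v y

/-- The number of conflicts between `v` and the members of `T`. -/
def con (φ : V → Bool) (v : V) (T : Finset V) : ℤ := ∑ y ∈ T, G.conf φ v y

/-- The number of conflicts that `v` would have with the members of `T` if it were coloured
`b`. -/
def clash (φ : V → Bool) (b : Bool) (v : V) (T : Finset V) : ℤ :=
  ∑ y ∈ T, if G.sign v y = some (xor b (φ y)) then 1 else 0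

/-- The number of edges inside `T`, as half the sum of the degrees in `T`. -/
def edges (T : Finset V) : ℤ := (∑ x ∈ T, G.nb x T) / 2

lemma con_eq_clash {φ : V → Bool} {b : Bool} {v : V} (h : φ v = b) (T : Finset V) :
    G.con φ v T = G.clash φ b v T := by subst h; rfl
lemma clash_nonneg (φ : V → Bool) (b : Bool) (v : V) (T : Finset V) : 0 ≤ G.clash φ b v T :=
  Finset.sum_nonneg fun y _ => by split_ifs <;> simp
lemma clash_congr {φ ψ : V → Bool} {b : Bool} {v : V} {T : Finset V}
    (h : ∀ y ∈ T, φ y = ψ y) : G.clash φ b v T = G.clash ψ b v T :=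
  Finset.sum_congr rfl fun y hy => by rw [h y hy]
lemma clash_add_clash (φ : V → Bool) (v : V) (T : Finset V) :
    G.clash φ false v T + G.clash φ true v T = G.nb v T := by
  unfold clash nb
  rw [← Finset.sum_add_distrib]
  refine Finset.sum_congr rfl fun y _ => ?_
  unfold ind
  rcases G.sign v y with _ | s
  · simp
  · cases s <;> cases φ y <;> simp
lemma clash_le_nb (φ : V → Bool) (b : Bool) (v : V) (T : Finset V) :
    G.clash φ b v T ≤ G.nb v T := by
  have h1 := G.clash_add_clash φ v T
  have h2 := G.clash_nonneg φ false v T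
  have h3 := G.clash_nonneg φ true v T
  cases b <;> linarith

lemma ind_comm (x y : V) : G.ind x y = G.ind y x := by simp [ind, G.symm x y]
lemma ind_self (x : V) : G.ind x x = 0 := by simp [ind, G.loopless]
lemma ind_nonneg (x y : V) : 0 ≤ G.ind x y := by unfold ind; split_ifs <;> simp
lemma ind_le_one (x y : V) : G.ind x y ≤ 1 := by unfold ind; split_ifs <;> simp
lemma conf_comm (φ : V → Bool) (x y : V) : G.conf φ x y = G.conf φ y x := by
  simp [conf, G.symm x y, Bool.xor_comm]
lemma conf_nonneg (φ : V → Bool) (x y : V) : 0 ≤ G.conf φ x y := by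
  unfold conf; split_ifs <;> simp
lemma conf_le_ind (φ : V → Bool) (x y : V) : G.conf φ x y ≤ G.ind x y := by
  unfold conf ind; split_ifs <;> simp_all
lemma conf_self (φ : V → Bool) (x : V) : G.conf φ x x = 0 := by simp [conf, G.loopless]
lemma conf_congr {φ ψ : V → Bool} {x y : V} (hx : φ x = ψ x) (hy : φ y = ψ y) :
    G.conf φ x y = G.conf ψ x y := by simp [conf, hx, hy]
lemma con_congr {φ ψ : V → Bool} {x : V} {T : Finset V} (hx : φ x = ψ x)
    (h : ∀ y ∈ T, φ y = ψ y) : G.con φ x T = G.con ψ x T :=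
  Finset.sum_congr rfl fun y hy => G.conf_congr hx (h y hy)
lemma con_nonneg (φ : V → Bool) (x : V) (T : Finset V) : 0 ≤ G.con φ x T :=
  Finset.sum_nonneg fun y _ => G.conf_nonneg φ x y
lemma con_le_nb (φ : V → Bool) (x : V) (T : Finset V) : G.con φ x T ≤ G.nb x T :=
  Finset.sum_le_sum fun y _ => G.conf_le_ind φ x y
lemma nb_nonneg (x : V) (T : Finset V) : 0 ≤ G.nb x T :=
  Finset.sum_nonneg fun y _ => G.ind_nonneg x y
lemma nb_mono (x : V) {S T : Finset V} (h : S ⊆ T) : G.nb x S ≤ G.nb x T :=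
  Finset.sum_le_sum_of_subset_of_nonneg h fun y _ _ => G.ind_nonneg x y
lemma ind_cases (x y : V) : G.ind x y = 0 ∨ G.ind x y = 1 := by
  unfold ind; split_ifs <;> simp
lemma conf_eq_zero_of_ind {φ : V → Bool} {x y : V} (h : G.ind x y = 0) : G.conf φ x y = 0 :=
  le_antisymm (h ▸ G.conf_le_ind φ x y) (G.conf_nonneg φ x y)

@[simp] lemma nb_empty (x : V) : G.nb x ∅ = 0 := by simp [nb]
@[simp] lemma nb_singleton (x y : V) : G.nb x {y} = G.ind x y := by simp [nb]
@[simp] lemma con_empty (φ : V → Bool) (x : V) : G.con φ x ∅ = 0 := by simp [con]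
@[simp] lemma con_singleton (φ : V → Bool) (x y : V) : G.con φ x {y} = G.conf φ x y := by
  simp [con]

@[simp] lemma edges_empty : G.edges ∅ = 0 := by simp [edges]

/-- The weight of a vertex `v` that may have at most `cap v b` conflicts when it is coloured `b`.
For the capacities `i` and `i + M` it equals `2 * i + 1`. Capacities may be negative. -/
def wt (M : ℤ) (cap : V → Bool → ℤ) (v : V) : ℤ := cap v false + cap v true + 1 - M

/-- The potential of a vertex set: its weight minus `i + 1` for each edge inside it. -/
def pot (i M : ℤ) (cap : V → Bool → ℤ) (T : Finset V) : ℤ :=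
  ∑ v ∈ T, wt M cap v - (i + 1) * G.edges T

variable {i M : ℤ} {cap : V → Bool → ℤ}

@[simp] lemma pot_empty : G.pot i M cap ∅ = 0 := by simp [pot]

/-- Lowering the capacities lowers the potential by the total decrement. -/
lemma pot_sub (d : V → Bool → ℤ) (T : Finset V) :
    G.pot i M (fun v b => cap v b - d v b) T
      = G.pot i M cap T - ∑ v ∈ T, (d v false + d v true) := by
  unfold pot wt
  simp only [Finset.sum_add_distrib, Finset.sum_sub_distrib]
  ring

variable [DecidableEq V]

lemma nb_insert (x : V) {v : V} {T : Finset V} (h : v ∉ T) :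
    G.nb x (insert v T) = G.ind x v + G.nb x T := Finset.sum_insert h
lemma con_insert (φ : V → Bool) (x : V) {v : V} {T : Finset V} (h : v ∉ T) :
    G.con φ x (insert v T) = G.conf φ x v + G.con φ x T := Finset.sum_insert h
lemma nb_union (x : V) {S T : Finset V} (h : Disjoint S T) :
    G.nb x (S ∪ T) = G.nb x S + G.nb x T := Finset.sum_union h
lemma con_union (φ : V → Bool) (x : V) {S T : Finset V} (h : Disjoint S T) :
    G.con φ x (S ∪ T) = G.con φ x S + G.con φ x T := Finset.sum_union h
lemma nb_union_inter (x : V) (S T : Finset V) :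
    G.nb x (S ∪ T) + G.nb x (S ∩ T) = G.nb x S + G.nb x T := Finset.sum_union_inter

lemma sum_nb_insert {v : V} {T : Finset V} (h : v ∉ T) :
    ∑ x ∈ insert v T, G.nb x (insert v T) = ∑ x ∈ T, G.nb x T + 2 * G.nb v T := by
  rw [Finset.sum_insert h, G.nb_insert v h, G.ind_self]
  have : ∑ x ∈ T, G.nb x (insert v T) = ∑ x ∈ T, (G.ind v x + G.nb x T) :=
    Finset.sum_congr rfl fun x _ => by rw [G.nb_insert x h, G.ind_comm]
  rw [this, Finset.sum_add_distrib]
  unfold nb; ring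

lemma two_mul_edges (T : Finset V) : 2 * G.edges T = ∑ x ∈ T, G.nb x T := by
  suffices h : 2 ∣ ∑ x ∈ T, G.nb x T from Int.mul_ediv_cancel' h
  induction T using Finset.induction_on with
  | empty => simp
  | insert v T h ih => rw [G.sum_nb_insert h]; exact dvd_add ih ⟨_, rfl⟩

lemma edges_insert {v : V} {T : Finset V} (h : v ∉ T) :
    G.edges (insert v T) = G.edges T + G.nb v T := by
  have h1 := G.two_mul_edges (insert v T)
  rw [G.sum_nb_insert h, ← G.two_mul_edges T] at h1
  linarith

lemma edges_union {X Y : Finset V} (h : Disjoint X Y) :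
    G.edges (X ∪ Y) = G.edges X + G.edges Y + ∑ y ∈ Y, G.nb y X := by
  induction Y using Finset.induction_on with
  | empty => simp
  | insert v Y hv ih =>
    rw [Finset.disjoint_insert_right] at h
    rw [Finset.union_insert, G.edges_insert (by simp [h.1, hv]), ih h.2, G.edges_insert hv,
      Finset.sum_insert hv, G.nb_union v h.2]
    ring

lemma edges_supermodular (X Y : Finset V) :
    G.edges X + G.edges Y ≤ G.edges (X ∪ Y) + G.edges (X ∩ Y) := by
  have h1 : X ∪ Y = X ∪ (Y \ X) := by simp
  have h2 : Y = (X ∩ Y) ∪ (Y \ X) := by ext; simp; tauto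
  have d1 : Disjoint X (Y \ X) := Finset.disjoint_sdiff
  have d2 : Disjoint (X ∩ Y) (Y \ X) := by
    rw [Finset.disjoint_left]; intro a; simp; tauto
  have e1 := G.edges_union d1
  have e2 := G.edges_union d2
  rw [← h1] at e1
  rw [← h2] at e2
  have : ∑ y ∈ Y \ X, G.nb y (X ∩ Y) ≤ ∑ y ∈ Y \ X, G.nb y X :=
    Finset.sum_le_sum fun y _ => G.nb_mono y Finset.inter_subset_left
  linarith

lemma pot_insert {v : V} {T : Finset V} (h : v ∉ T) :
    G.pot i M cap (insert v T) = G.pot i M cap T + wt M cap v - (i + 1) * G.nb v T := by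
  unfold pot; rw [Finset.sum_insert h, G.edges_insert h]; ring

@[simp] lemma pot_singleton (v : V) : G.pot i M cap {v} = wt M cap v := by
  rw [← insert_empty_eq, G.pot_insert (by simp)]; simp

lemma pot_union {X Y : Finset V} (h : Disjoint X Y) :
    G.pot i M cap (X ∪ Y)
      = G.pot i M cap X + G.pot i M cap Y - (i + 1) * ∑ y ∈ Y, G.nb y X := by
  unfold pot; rw [Finset.sum_union h, G.edges_union h]; ring

lemma pot_submodular (hi : 0 ≤ i) (X Y : Finset V) :
    G.pot i M cap (X ∪ Y) + G.pot i M cap (X ∩ Y) ≤ G.pot i M cap X + G.pot i M cap Y := by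
  unfold pot
  have h1 := Finset.sum_union_inter (s₁ := X) (s₂ := Y) (f := wt M cap)
  have h2 := mul_le_mul_of_nonneg_left (G.edges_supermodular X Y) (by linarith : 0 ≤ i + 1)
  linarith

/-- If a submodular function becomes nonnegative on all subsets of `Z` after paying `i` for each
element of `N`, then paying for a subset `S` of `N` is enough, of size at most any upper bound `q`
of `-base`. Indeed, in a fractional payment of least total every paid element lies in a tight set,
tight sets are closed under union, and the total payment equals `-base Y` for the union `Y` of these
tight sets. -/
lemma exists_selection {N Z : Finset V} {base : Finset V → ℤ} {i q : ℤ}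
    (hi : 0 ≤ i) (h0 : base ∅ = 0)
    (hsub : ∀ X ⊆ Z, ∀ Y ⊆ Z, base (X ∪ Y) + base (X ∩ Y) ≤ base X + base Y)
    (h1 : ∀ Y ⊆ Z, 0 ≤ base Y + i * (Y ∩ N).card) (h2 : ∀ Y ⊆ Z, -base Y ≤ q) :
    ∃ S ⊆ N, (S.card : ℤ) ≤ q ∧ ∀ Y ⊆ Z, 0 ≤ base Y + i * (Y ∩ S).card := by
  classical
  let P : (V → ℤ) → Prop := fun c => (∀ y, 0 ≤ c y ∧ c y ≤ i) ∧ (∀ y ∉ N, c y = 0) ∧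
    ∀ Y ⊆ Z, 0 ≤ base Y + ∑ y ∈ Y, c y
  have hP0 : P (fun y => if y ∈ N then i else 0) := by
    refine ⟨fun y => by dsimp only; split_ifs <;> simp [hi], fun y hy => by simp [hy], fun Y hY => ?_⟩
    rw [← Finset.sum_filter, Finset.sum_const, Finset.filter_mem_eq_inter, nsmul_eq_mul, mul_comm]
    exact h1 Y hY
  -- `c` is a fractional payment of least total
  obtain ⟨c, hc, hmin⟩ : ∃ c, P c ∧ ∀ c', P c' → ∑ y ∈ N, c y ≤ ∑ y ∈ N, c' y := by
    have hex : ∃ n : ℕ, ∃ c, P c ∧ ∑ y ∈ N, c y = n := by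
      refine ⟨(∑ y ∈ N, if y ∈ N then i else 0).toNat, _, hP0, ?_⟩
      rw [Int.toNat_of_nonneg]
      exact Finset.sum_nonneg fun y _ => (hP0.1 y).1
    obtain ⟨c, hc, hcn⟩ := Nat.find_spec hex
    refine ⟨c, hc, fun c' hc' => ?_⟩
    have hnn : 0 ≤ ∑ y ∈ N, c' y := Finset.sum_nonneg fun y _ => (hc'.1 y).1
    have := Nat.find_min' hex ⟨c', hc', (Int.toNat_of_nonneg hnn).symm⟩
    rw [hcn]; omega
  let S := N.filter fun y => 0 < c y
  have tight : ∀ y ∈ S, ∃ Y ⊆ Z, y ∈ Y ∧ base Y + ∑ y ∈ Y, c y = 0 := by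
    intro y hy
    obtain ⟨hyN, hyc⟩ := Finset.mem_filter.1 hy
    by_contra hcon
    push Not at hcon
    have hsum : ∀ Y : Finset V, ∑ x ∈ Y, (c x - if x = y then 1 else 0)
        = ∑ x ∈ Y, c x - if y ∈ Y then 1 else 0 := by
      intro Y; rw [Finset.sum_sub_distrib, Finset.sum_ite_eq']
    have := hmin (fun x => c x - if x = y then 1 else 0) ⟨fun x => ?_, fun x hx => ?_,
      fun Y hY => ?_⟩
    · rw [hsum, if_pos hyN] at this; linarith
    · have := hc.1 x
      dsimp only
      split_ifs with h
      · subst h; omega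
      · omega
    · have : x ≠ y := by rintro rfl; exact hx hyN
      simp [this, hc.2.1 x hx]
    · rw [hsum]
      have h3 := hc.2.2 Y hY
      split_ifs with h
      · have := hcon Y hY h; omega
      · omega
  have cover : ∀ S' ⊆ S, ∃ Y ⊆ Z, S' ⊆ Y ∧ base Y + ∑ y ∈ Y, c y = 0 := by
    intro S'
    induction S' using Finset.induction_on with
    | empty => intro _; exact ⟨∅, by simp, by simp, by simp [h0]⟩
    | insert y S' hy ih =>
      intro hS
      obtain ⟨Y1, a1, b1, c1⟩ := ih fun x hx => hS (Finset.mem_insert_of_mem hx)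
      obtain ⟨Y2, a2, b2, c2⟩ := tight y (hS (Finset.mem_insert_self _ _))
      refine ⟨Y1 ∪ Y2, Finset.union_subset a1 a2, ?_, ?_⟩
      · intro x hx
        rcases Finset.mem_insert.1 hx with rfl | hx
        · exact Finset.mem_union_right _ b2
        · exact Finset.mem_union_left _ (b1 hx)
      · have u := hc.2.2 _ (Finset.union_subset a1 a2)
        have v := hc.2.2 _ (Finset.inter_subset_left.trans a1 : Y1 ∩ Y2 ⊆ Z)
        have s := hsub Y1 a1 Y2 a2
        have t := Finset.sum_union_inter (s₁ := Y1) (s₂ := Y2) (f := c)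
        linarith
  refine ⟨S, Finset.filter_subset _ _, ?_, fun Y hY => ?_⟩
  · obtain ⟨Y, hYZ, hSY, ht⟩ := cover S subset_rfl
    have a := h2 Y hYZ
    have b : (S.card : ℤ) ≤ ∑ y ∈ S, c y := by
      rw [Finset.card_eq_sum_ones]; push_cast
      exact Finset.sum_le_sum fun y hy => by
        have := (Finset.mem_filter.1 hy).2; omega
    have d : ∑ y ∈ S, c y ≤ ∑ y ∈ Y, c y :=
      Finset.sum_le_sum_of_subset_of_nonneg hSY fun y _ _ => (hc.1 y).1
    linarith
  · have a := hc.2.2 Y hY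
    have b : ∑ y ∈ Y, c y ≤ i * (Y ∩ S).card := by
      rw [mul_comm, ← nsmul_eq_mul, ← Finset.sum_const]
      rw [← Finset.filter_mem_eq_inter, Finset.sum_filter]
      refine Finset.sum_le_sum fun y _ => ?_
      split_ifs with h
      · exact (hc.1 y).2
      · by_cases hy : y ∈ N
        · have := (hc.1 y).1
          by_contra h'
          exact h (Finset.mem_filter.2 ⟨hy, by omega⟩)
        · exact (hc.2.1 y hy).le
    linarith

end SignedGraph

/-! ### Colouring with forbidden colours -/

namespace SignedGraph

variable {V : Type u} (G : SignedGraph V)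

/-- The capacities on `A` are at most `i` for poor and at most `i + M` for rich. -/
def Bounded (i M : ℤ) (cap : V → Bool → ℤ) (A : Finset V) : Prop :=
  ∀ v ∈ A, cap v false ≤ i ∧ cap v true ≤ i + M

/-- Every nonempty subset of `A` has potential at least `-M`. -/
def Sparse (i M : ℤ) (cap : V → Bool → ℤ) (A : Finset V) : Prop :=
  ∀ T ⊆ A, T.Nonempty → -M ≤ G.pot i M cap T

/-- Some colouring respects the capacities on `A`. -/
def Colorable (cap : V → Bool → ℤ) (A : Finset V) : Prop :=
  ∃ φ : V → Bool, ∀ v ∈ A, G.con φ v A ≤ cap v (φ v)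

/-- Some colouring respects the capacities on `A` and uses no forbidden colour. -/
def ColorableAvoiding (cap : V → Bool → ℤ) (kill : V → Option Bool) (A : Finset V) : Prop :=
  ∃ φ : V → Bool, ∀ v ∈ A, G.con φ v A ≤ cap v (φ v) ∧ kill v ≠ some (φ v)

/-- The induction hypothesis: sparse sets with fewer than `N` vertices are colourable. -/
def SparseColorable (i M : ℤ) (N : ℕ) : Prop :=
  ∀ (A : Finset V) (cap : V → Bool → ℤ), A.card < N → Bounded i M cap A →
    G.Sparse i M cap A → G.Colorable cap A

/-- The number of vertices of `T` with a forbidden colour. -/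
def kills (kill : V → Option Bool) (T : Finset V) : ℤ :=
  ∑ v ∈ T, if (kill v).isSome then 1 else 0

variable {G} {i M : ℤ} {cap : V → Bool → ℤ} {kill : V → Option Bool}

lemma Bounded.mono {A B : Finset V} (h : Bounded i M cap A) (hBA : B ⊆ A) : Bounded i M cap B :=
  fun v hv => h v (hBA hv)

lemma Bounded.sub {A : Finset V} (h : Bounded i M cap A) {d : V → Bool → ℤ}
    (hd : ∀ v b, 0 ≤ d v b) : Bounded i M (fun v b => cap v b - d v b) A := fun v hv => by
  have := h v hv; have := hd v false; have := hd v true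
  dsimp only; constructor <;> linarith

lemma Sparse.mono {A B : Finset V} (h : G.Sparse i M cap A) (hBA : B ⊆ A) :
    G.Sparse i M cap B := fun T hT => h T (hT.trans hBA)

lemma Bounded.wt_le {A : Finset V} (h : Bounded i M cap A) {v : V} (hv : v ∈ A) :
    wt M cap v ≤ 2 * i + 1 := by
  have := h v hv; unfold wt; linarith

lemma kills_nonneg (T : Finset V) : 0 ≤ kills kill T :=
  Finset.sum_nonneg fun v _ => by split_ifs <;> simp

lemma SparseColorable.mono {N N' : ℕ} (h : G.SparseColorable i M N) (hN : N' ≤ N) :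
    G.SparseColorable i M N' := fun A cap hA => h A cap (hA.trans_le hN)

variable [DecidableEq V]

lemma kills_insert {v : V} {T : Finset V} (h : v ∉ T) :
    kills kill (insert v T) = (if (kill v).isSome then 1 else 0) + kills kill T :=
  Finset.sum_insert h

/-- Colour `z` first, with `c`. The neighbours of `z` fall into two parts: those in a set `S` of
size at most `cap z c` may be in conflict with `z` and lose one unit of the capacity of one colour,
while the others get a forbidden colour. The uncrossing lemma provides `S` such that the rest can
still be coloured by `hX`. -/
lemma colorableAvoiding_of_forced (hi : 0 ≤ i) {Z : Finset V} {z : V} (hz : z ∈ Z) (c : Bool)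
    (hc : kill z ≠ some c) (hb : Bounded i M cap Z)
    (h1 : ∀ Y ⊆ Z.erase z, 0 ≤ G.pot i M cap Y - (i + 1) * kills kill Y - G.nb z Y)
    (h2 : ∀ Y ⊆ Z.erase z,
      -(G.pot i M cap Y - (i + 1) * kills kill Y - (i + 1) * G.nb z Y) ≤ cap z c)
    (hX : ∀ cap' kill', Bounded i M cap' (Z.erase z) →
      (∀ Y ⊆ Z.erase z, 0 ≤ G.pot i M cap' Y - (i + 1) * kills kill' Y) →
      G.ColorableAvoiding cap' kill' (Z.erase z)) :
    G.ColorableAvoiding cap kill Z := by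
  classical
  let N := (Z.erase z).filter fun y => (G.sign z y).isSome
  have hN : N ⊆ Z.erase z := Finset.filter_subset _ _
  have nbN : ∀ Y ⊆ Z.erase z, G.nb z Y = ((Y ∩ N).card : ℤ) := by
    intro Y hY
    have : Y ∩ N = Y.filter fun y => (G.sign z y).isSome := by
      ext y; simp only [N, Finset.mem_inter, Finset.mem_filter]
      exact ⟨fun h => ⟨h.1, h.2.2⟩, fun h => ⟨h.1, hY h.1, h.2⟩⟩
    rw [this, Finset.card_filter]; push_cast; rfl
  obtain ⟨S, hSN, hSq, hS⟩ := exists_selection (N := N) (Z := Z.erase z) (i := i) (q := cap z c)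
    (base := fun Y => G.pot i M cap Y - (i + 1) * kills kill Y - (i + 1) * G.nb z Y) hi
    (by simp [kills])
    (fun X _ Y _ => by
      have a := G.pot_submodular (M := M) (cap := cap) hi X Y
      have b : kills kill (X ∪ Y) + kills kill (X ∩ Y) = kills kill X + kills kill Y :=
        Finset.sum_union_inter
      have d := G.nb_union_inter z X Y
      linear_combination a - (i + 1) * b - (i + 1) * d)
    (fun Y hY => by
      have := h1 Y hY
      rw [nbN Y hY] at this ⊢; linarith) h2
  -- a neighbour of `z` outside `S` has no forbidden colour yet
  have free : ∀ y ∈ N, y ∉ S → kill y = none := by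
    intro y hy hyS
    have a := hS {y} (by simpa using hN hy)
    have b : ({y} : Finset V) ∩ S = ∅ := Finset.singleton_inter_of_notMem hyS
    have d := hb.wt_le (Finset.mem_of_mem_erase (hN hy))
    have e : G.ind z y = 1 := by simp [ind, (Finset.mem_filter.1 hy).2]
    rw [b, pot_singleton, nb_singleton, e] at a
    by_contra hne
    have f : kills kill {y} = 1 := by
      simp [kills, Option.isSome_iff_ne_none, hne]
    rw [f] at a; simp at a; linarith
  let d : V → Bool → ℤ := fun y b => if y ∈ S ∧ G.sign z y = some (xor c b) then 1 else 0
  let kill' : V → Option Bool := fun y => if y ∈ N \ S then (G.sign z y).map (xor c) else kill y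
  obtain ⟨φ, hφ⟩ := hX (fun v b => cap v b - d v b) kill'
    ((hb.mono (Finset.erase_subset _ _)).sub fun v b => by
      simp only [d]; split_ifs <;> simp) (by
    intro Y hY
    have a := hS Y hY
    rw [G.pot_sub d]
    have hd : ∑ v ∈ Y, (d v false + d v true) = (Y ∩ S).card := by
      rw [← Finset.filter_mem_eq_inter, Finset.card_filter]; push_cast
      refine Finset.sum_congr rfl fun y _ => ?_
      by_cases hy : y ∈ S
      · have := (Finset.mem_filter.1 (hSN hy)).2
        rcases hs : G.sign z y with _ | s
        · simp [hs] at this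
        · cases s <;> cases c <;> simp [d, hy, hs]
      · simp [d, hy]
    have hk : kills kill' Y = kills kill Y + (G.nb z Y - (Y ∩ S).card) := by
      have hsub : Y ∩ S ⊆ Y ∩ N := Finset.inter_subset_inter_left hSN
      have hcard : G.nb z Y - ((Y ∩ S).card : ℤ) = (Y.filter fun y => y ∈ N \ S).card := by
        have : Y.filter (fun y => y ∈ N \ S) = (Y ∩ N) \ (Y ∩ S) := by
          ext y; simp only [Finset.mem_filter, Finset.mem_sdiff, Finset.mem_inter]; tauto
        rw [this, nbN Y hY, Finset.cast_card_sdiff hsub]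
      rw [hcard, Finset.card_filter]; push_cast
      unfold kills
      rw [← Finset.sum_add_distrib]
      refine Finset.sum_congr rfl fun y _ => ?_
      by_cases hy : y ∈ N \ S
      · have h0 := free y (Finset.mem_sdiff.1 hy).1 (Finset.mem_sdiff.1 hy).2
        have := (Finset.mem_filter.1 (Finset.mem_sdiff.1 hy).1).2
        simp only [kill', if_pos hy, h0, Option.isSome_map, this]; simp
      · simp only [kill', if_neg hy, add_zero]
    rw [hd, hk]
    linarith)
  have hzc : ∀ y ∈ Z.erase z, y ≠ z := fun y hy => Finset.ne_of_mem_erase hy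
  let ψ := Function.update φ z c
  have ψz : ψ z = c := Function.update_self ..
  have ψy : ∀ y ∈ Z.erase z, ψ y = φ y := fun y hy => Function.update_of_ne (hzc y hy) ..
  have hconf : ∀ y ∈ Z.erase z, G.conf ψ z y ≤ if y ∈ S then d y (φ y) else 0 := by
    intro y hy
    unfold conf
    rw [ψz, ψy y hy]
    by_cases hyS : y ∈ S
    · simp [d, hyS]
    · by_cases hyN : y ∈ N
      · have h3 := (hφ y hy).2
        have hm : y ∈ N \ S := Finset.mem_sdiff.2 ⟨hyN, hyS⟩
        simp only [kill', if_pos hm] at h3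
        rw [if_neg hyS, if_neg]
        intro hs; rw [hs] at h3; simp at h3
      · have : G.sign z y = none := by
          by_contra hne
          exact hyN (Finset.mem_filter.2 ⟨hy, Option.isSome_iff_ne_none.2 hne⟩)
        simp [this, hyS]
  refine ⟨ψ, fun v hv => ?_⟩
  have hZ : Z = insert z (Z.erase z) := (Finset.insert_erase hz).symm
  rw [hZ, G.con_insert ψ v (Finset.notMem_erase z Z)]
  by_cases hvz : v = z
  · subst hvz
    rw [G.conf_self, ψz]
    refine ⟨?_, hc⟩
    have : G.con ψ v (Z.erase v) ≤ S.card := by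
      calc G.con ψ v (Z.erase v) ≤ ∑ y ∈ Z.erase v, if y ∈ S then d y (φ y) else 0 :=
            Finset.sum_le_sum hconf
        _ ≤ ∑ y ∈ Z.erase v, if y ∈ S then 1 else 0 := by
            refine Finset.sum_le_sum fun y _ => ?_
            split_ifs
            · simp only [d]; split_ifs <;> simp
            · rfl
        _ = ((Z.erase v) ∩ S).card := by
            rw [← Finset.filter_mem_eq_inter, Finset.card_filter]; push_cast; rfl
        _ ≤ S.card := by exact_mod_cast Finset.card_le_card Finset.inter_subset_right
    linarith
  · have hv' : v ∈ Z.erase z := Finset.mem_erase.2 ⟨hvz, hv⟩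
    obtain ⟨a, b⟩ := hφ v hv'
    have e := hconf v hv'
    rw [G.con_congr (ψy v hv') ψy, ψy v hv', G.conf_comm]
    constructor
    · dsimp only at a
      have : (if v ∈ S then d v (φ v) else 0) ≤ d v (φ v) := by
        split_ifs with h
        · rfl
        · simp [d, h]
      linarith
    · by_cases hm : v ∈ N \ S
      · rw [free v (Finset.mem_sdiff.1 hm).1 (Finset.mem_sdiff.1 hm).2]; simp
      · simpa only [kill', if_neg hm] using b

/-- A set whose subsets have nonnegative potential even after charging `i + 1` for each
forbidden colour can be coloured. A vertex with a forbidden colour is coloured first, with its other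
colour. -/
lemma SparseColorable.colorableAvoiding {N : ℕ} (ih : G.SparseColorable i M N) (hi : 0 ≤ i)
    (hM : 0 ≤ M) (Z : Finset V) :
    ∀ (cap : V → Bool → ℤ) (kill : V → Option Bool), Z.card < N → Bounded i M cap Z →
    (∀ Y ⊆ Z, 0 ≤ G.pot i M cap Y - (i + 1) * kills kill Y) →
    G.ColorableAvoiding cap kill Z := by
  induction Z using Finset.strongInduction with
  | H Z rec =>
  intro cap kill hZ hb hp
  by_cases hk : ∀ z ∈ Z, kill z = none
  · obtain ⟨φ, hφ⟩ := ih Z cap hZ hb fun T hT _ => by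
      have a := hp T hT
      have b : 0 ≤ kills kill T := kills_nonneg T
      have := mul_nonneg (by linarith : 0 ≤ i + 1) b
      linarith
    exact ⟨φ, fun v hv => ⟨hφ v hv, by simp [hk v hv]⟩⟩
  · push Not at hk
    obtain ⟨z, hz, hkz⟩ := hk
    obtain ⟨β, hβ⟩ := Option.ne_none_iff_exists'.1 hkz
    have key : ∀ Y ⊆ Z.erase z, wt M cap z - (i + 1) + 0 ≤ wt M cap z - (i + 1) +
        (G.pot i M cap (insert z Y) - (i + 1) * kills kill (insert z Y)) ∧
        wt M cap z - (i + 1) +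
        (G.pot i M cap Y - (i + 1) * kills kill Y - (i + 1) * G.nb z Y) =
        G.pot i M cap (insert z Y) - (i + 1) * kills kill (insert z Y) := by
      intro Y hY
      have hzY : z ∉ Y := fun h => Finset.notMem_erase z Z (hY h)
      have a := hp (insert z Y) (Finset.insert_subset hz (hY.trans (Finset.erase_subset _ _)))
      refine ⟨by linarith, ?_⟩
      rw [G.pot_insert hzY, kills_insert hzY, hβ]; simp; ring
    have hle := hb.wt_le hz
    refine colorableAvoiding_of_forced hi hz (!β) (by rw [hβ]; simp) hb ?_ ?_ ?_
    · intro Y hY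
      obtain ⟨a, b⟩ := key Y hY
      rcases (G.nb_nonneg z Y).eq_or_lt with h0 | h0
      · rw [← h0]; have := hp Y (hY.trans (Finset.erase_subset _ _)); linarith
      · have : i * 1 ≤ i * G.nb z Y := mul_le_mul_of_nonneg_left h0 hi
        linarith
    · intro Y hY
      obtain ⟨a, b⟩ := key Y hY
      have h3 := hb z hz
      have : wt M cap z - (i + 1) ≤ cap z (!β) := by
        unfold wt; cases β <;> simp <;> linarith
      linarith
    · intro cap' kill' hb' hp'
      exact rec _ (Finset.erase_ssubset hz) cap' kill'
        ((Finset.card_lt_card (Finset.erase_ssubset hz)).trans hZ) hb' hp'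

open Classical in
/-- The colour forbidden to `z` by the colouring `φ` of a set `T` that contains at most one
neighbour of `z`. -/
noncomputable def forbid (G : SignedGraph V) (φ : V → Bool) (T : Finset V) (z : V) :
    Option Bool :=
  if h : ∃ t ∈ T, (G.sign z t).isSome then (G.sign z h.choose).map (xor (φ h.choose)) else none

lemma eq_of_nb_le_one {z : V} {T : Finset V} (h : G.nb z T ≤ 1) {s t : V} (hs : s ∈ T)
    (ht : t ∈ T) (hzs : G.ind z s = 1) (hzt : G.ind z t = 1) : s = t := by
  by_contra hne
  have : G.nb z {s, t} ≤ G.nb z T := G.nb_mono z (by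
    intro x hx; rcases Finset.mem_insert.1 hx with rfl | hx
    · exact hs
    · rwa [Finset.mem_singleton.1 hx])
  rw [G.nb_insert z (by simpa using hne), nb_singleton] at this
  linarith

lemma ind_eq_one_iff {x y : V} : G.ind x y = 1 ↔ (G.sign x y).isSome := by
  unfold ind; split_ifs with h <;> simp [h]

lemma nb_pos_of_ind {z t : V} {T : Finset V} (ht : t ∈ T) (h : G.ind z t = 1) : 1 ≤ G.nb z T := by
  have := G.nb_mono z (Finset.singleton_subset_iff.2 ht)
  rwa [nb_singleton, h] at this

lemma exists_of_nb_pos {z : V} {T : Finset V} (h : 0 < G.nb z T) : ∃ t ∈ T, G.ind z t = 1 := by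
  by_contra hne
  push Not at hne
  have : G.nb z T = 0 := Finset.sum_eq_zero fun t ht => (G.ind_cases z t).resolve_right (hne t ht)
  omega

lemma kills_forbid_le (φ : V → Bool) (T Y : Finset V) :
    kills (G.forbid φ T) Y ≤ ∑ y ∈ Y, G.nb y T := by
  refine Finset.sum_le_sum fun y _ => ?_
  split_ifs with h
  · unfold forbid at h
    split_ifs at h with h'
    · obtain ⟨t, ht, hs⟩ := h'
      exact nb_pos_of_ind ht (ind_eq_one_iff.2 hs)
    · simp at h
  · exact G.nb_nonneg y T

lemma forbid_eq {φ : V → Bool} {T : Finset V} {z : V} (h : G.nb z T ≤ 1) {t : V} (ht : t ∈ T)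
    {s : Bool} (hs : G.sign z t = some s) : G.forbid φ T z = some (xor (φ t) s) := by
  have hex : ∃ t ∈ T, (G.sign z t).isSome := ⟨t, ht, by simp [hs]⟩
  have heq : hex.choose = t := eq_of_nb_le_one h hex.choose_spec.1 ht
    (ind_eq_one_iff.2 hex.choose_spec.2) (ind_eq_one_iff.2 (by simp [hs]))
  unfold forbid
  rw [dif_pos hex, heq, hs]
  rfl

lemma sign_ne_of_forbid_ne {φ : V → Bool} {T : Finset V} {z : V} {b : Bool} (h : G.nb z T ≤ 1)
    (hb : G.forbid φ T z ≠ some b) {t : V} (ht : t ∈ T) : G.sign z t ≠ some (xor b (φ t)) := by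
  intro hs
  apply hb
  rw [forbid_eq h ht hs]
  cases b <;> cases φ t <;> rfl

lemma nb_sdiff_add {z : V} {A T : Finset V} (h : T ⊆ A) : G.nb z (A \ T) + G.nb z T = G.nb z A :=
  Finset.sum_sdiff h

lemma exists_glue (T : Finset V) (φ χ : V → Bool) :
    ∃ ψ : V → Bool, (∀ t ∈ T, ψ t = φ t) ∧ ∀ z ∉ T, ψ z = χ z :=
  ⟨fun v => if v ∈ T then φ v else χ v, fun _ ht => if_pos ht, fun _ hz => if_neg hz⟩

/-- A colouring of `T` extends, without conflicts between `T` and `Z`, to vertices with at most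
one neighbour in `T`. -/
lemma exists_extension (φ : V → Bool) {T Z : Finset V} (hd : Disjoint T Z)
    (h : ∀ z ∈ Z, G.nb z T ≤ 1) :
    ∃ ψ : V → Bool, (∀ t ∈ T, ψ t = φ t) ∧ ∀ z ∈ Z, G.con ψ z T = 0 := by
  have : ∀ z, ∃ b, G.forbid φ T z ≠ some b := fun z => by
    rcases G.forbid φ T z with _ | c
    · exact ⟨true, by simp⟩
    · exact ⟨!c, by simp⟩
  choose χ hχ using this
  obtain ⟨ψ, h1, h2⟩ := exists_glue T φ χ
  refine ⟨ψ, h1, fun z hz => Finset.sum_eq_zero fun t ht => if_neg ?_⟩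
  rw [h2 z (Finset.disjoint_right.1 hd hz), h1 t ht]
  exact sign_ne_of_forbid_ne (h z hz) (hχ z) ht

/-- A colouring of `T` extends to `A` if no set between `T` and `A` has smaller potential
than `T`. -/
lemma SparseColorable.colorable_of_extension {N : ℕ} (ih : G.SparseColorable i M N) (hi : 0 ≤ i)
    (hM : 0 ≤ M) {A T : Finset V} (hTA : T ⊆ A) (hT : G.Colorable cap T)
    (hb : Bounded i M cap A) (hN : (A \ T).card < N)
    (hp : ∀ Y ⊆ A \ T, G.pot i M cap T ≤ G.pot i M cap (T ∪ Y)) : G.Colorable cap A := by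
  obtain ⟨φ, hφ⟩ := hT
  have hd : Disjoint T (A \ T) := Finset.disjoint_sdiff
  have hnb : ∀ z ∈ A \ T, G.nb z T ≤ 1 := by
    intro z hz
    have a := hp {z} (Finset.singleton_subset_iff.2 hz)
    rw [G.pot_union (Finset.disjoint_of_subset_right (Finset.singleton_subset_iff.2 hz) hd)] at a
    simp only [pot_singleton, Finset.sum_singleton] at a
    have b := hb.wt_le (Finset.mem_sdiff.1 hz).1
    by_contra hlt
    have : (i + 1) * 2 ≤ (i + 1) * G.nb z T := mul_le_mul_of_nonneg_left (by omega) (by omega)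
    linarith
  obtain ⟨χ, hχ⟩ := ih.colorableAvoiding hi hM (A \ T) cap (G.forbid φ T) hN
    (hb.mono Finset.sdiff_subset) (fun Y hY => by
      have a := hp Y hY
      rw [G.pot_union (Finset.disjoint_of_subset_right hY hd)] at a
      have b := mul_le_mul_of_nonneg_left (kills_forbid_le (G := G) φ T Y)
        (by omega : 0 ≤ i + 1)
      linarith)
  obtain ⟨ψ, h1, h2⟩ := exists_glue T φ χ
  have h2' : ∀ z ∈ A \ T, ψ z = χ z := fun z hz => h2 z (Finset.mem_sdiff.1 hz).2
  have hc : ∀ z ∈ A \ T, ∀ t ∈ T, G.conf ψ z t = 0 := by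
    intro z hz t ht
    refine if_neg ?_
    rw [h2' z hz, h1 t ht]
    exact sign_ne_of_forbid_ne (hnb z hz) (hχ z hz).2 ht
  refine ⟨ψ, fun v hv => ?_⟩
  rw [← Finset.union_sdiff_of_subset hTA, G.con_union ψ v hd]
  by_cases hvT : v ∈ T
  · have : G.con ψ v (A \ T) = 0 :=
      Finset.sum_eq_zero fun z hz => by rw [G.conf_comm]; exact hc z hz v hvT
    rw [this, G.con_congr (h1 v hvT) h1, h1 v hvT, add_zero]
    exact hφ v hvT
  · have hv' : v ∈ A \ T := Finset.mem_sdiff.2 ⟨hv, hvT⟩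
    have : G.con ψ v T = 0 := Finset.sum_eq_zero fun t ht => hc v hv' t ht
    rw [this, G.con_congr (h2' v hv') h2', h2' v hv', zero_add]
    exact (hχ v hv').1

end SignedGraph

/-! ### Minimal counterexamples -/

namespace SignedGraph

variable {V : Type u} (G : SignedGraph V)

/-- A sparse set that cannot be coloured although all smaller sparse sets can. -/
structure Obstruction (i M : ℤ) (cap : V → Bool → ℤ) (A : Finset V) : Prop where
  one_le : 1 ≤ i
  le : i ≤ M
  bounded : Bounded i M cap A
  sparse : G.Sparse i M cap A
  ih : G.SparseColorable i M A.card
  not_colorable : ¬ G.Colorable cap A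

/-- A link of `A`: a vertex of full weight with exactly two neighbours in `A`. -/
def IsLink (i M : ℤ) (cap : V → Bool → ℤ) (A : Finset V) (v : V) : Prop :=
  wt M cap v = 2 * i + 1 ∧ G.nb v A = 2

variable {G} {i M : ℤ} {cap : V → Bool → ℤ} {A : Finset V}

namespace Obstruction

lemma cap_of_wt (h : G.Obstruction i M cap A) {v : V} (hv : v ∈ A) (hw : wt M cap v = 2 * i + 1) :
    cap v false = i ∧ cap v true = i + M := by
  have := h.bounded v hv
  unfold wt at hw
  constructor <;> linarith

lemma one_le_cap (h : G.Obstruction i M cap A) {v : V} (hv : v ∈ A) (hw : wt M cap v = 2 * i + 1)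
    (b : Bool) : 1 ≤ cap v b := by
  have := h.cap_of_wt hv hw
  have := h.one_le
  have := h.le
  cases b <;> linarith

variable [DecidableEq V]

/-- Colouring a proper subset within capacities lowered by `d`. -/
lemma colorable_of_ssubset (h : G.Obstruction i M cap A) {T : Finset V} (hT : T ⊂ A)
    {d : V → Bool → ℤ} (hd : ∀ v b, 0 ≤ d v b)
    (hp : ∀ Y ⊆ T, Y.Nonempty → -M ≤ G.pot i M cap Y - ∑ v ∈ Y, (d v false + d v true)) :
    ∃ φ : V → Bool, ∀ v ∈ T, G.con φ v T ≤ cap v (φ v) - d v (φ v) :=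
  h.ih T (fun v b => cap v b - d v b) (Finset.card_lt_card hT)
    ((h.bounded.mono hT.1).sub hd) fun Y hY hne => by rw [G.pot_sub d]; exact hp Y hY hne

/-- Proper nonempty subsets have potential more than `-M`: a colouring of a subset of potential
`-M` would extend. -/
lemma pot_ge_one (h : G.Obstruction i M cap A) {T : Finset V} (hT : T ⊂ A) (hne : T.Nonempty) :
    1 - M ≤ G.pot i M cap T := by
  by_contra hlt
  have hi := h.one_le
  have hM := h.le
  refine h.not_colorable (h.ih.colorable_of_extension (by omega) (by omega) hT.1
    (h.ih T cap (Finset.card_lt_card hT) (h.bounded.mono hT.1) (h.sparse.mono hT.1))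
    h.bounded (Finset.card_lt_card (Finset.sdiff_ssubset hT.1 hne)) fun Y hY => ?_)
  have := h.sparse (T ∪ Y) (Finset.union_subset hT.1 (hY.trans Finset.sdiff_subset))
    (hne.mono Finset.subset_union_left)
  omega

/-- After the deletion of a vertex that is not a link, the capacity of each of its neighbours may
be lowered by one. -/
lemma pot_ge_nb (h : G.Obstruction i M cap A) {v : V} (hv : v ∈ A) (hl : ¬ G.IsLink i M cap A v)
    {T : Finset V} (hT : T ⊆ A.erase v) (hne : T.Nonempty) :
    G.nb v T - M ≤ G.pot i M cap T := by
  have hi := h.one_le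
  have hvT : v ∉ T := fun h' => Finset.notMem_erase v A (hT h')
  have hTA : T ⊂ A := (Finset.ssubset_iff_of_subset (hT.trans (Finset.erase_subset _ _))).2
    ⟨v, hv, hvT⟩
  have h1 := h.pot_ge_one hTA hne
  have hins : insert v T ⊆ A := Finset.insert_subset hv hTA.1
  have h2 := h.sparse (insert v T) hins (Finset.insert_nonempty _ _)
  have h4 : insert v T ≠ A → 1 - M ≤ G.pot i M cap (insert v T) := fun hn =>
    h.pot_ge_one (hins.ssubset_of_ne hn) (Finset.insert_nonempty _ _)
  rw [G.pot_insert hvT] at h2 h4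
  have h3 := h.bounded.wt_le hv
  have h0 := G.nb_nonneg v T
  rcases lt_or_ge (G.nb v T) 2 with hk | hk
  · omega
  rcases hk.eq_or_lt with hk | hk
  · rw [← hk] at h2 h4 ⊢
    by_cases heq : insert v T = A
    · have : wt M cap v ≠ 2 * i + 1 := fun hw => hl ⟨hw, by
        rw [← heq, G.nb_insert v hvT, G.ind_self, ← hk]; rfl⟩
      have : wt M cap v ≤ 2 * i := by omega
      linarith
    · have := h4 heq
      linarith
  · have : i * 3 ≤ i * G.nb v T := mul_le_mul_of_nonneg_left (by omega) (by omega)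
    linarith

/-- A vertex of small degree can be coloured last: with the rich node if it has at most `cap v true`
neighbours, and with either node if it has one more, since the two nodes are then in conflict with
complementary sets of neighbours. -/
lemma nb_lower_bounds (h : G.Obstruction i M cap A) {v : V} (hv : v ∈ A)
    (hl : ¬ G.IsLink i M cap A v) (hb : 0 ≤ cap v true) :
    cap v true + 1 ≤ G.nb v A ∧ (0 ≤ cap v false → cap v true + 2 ≤ G.nb v A) := by
  let d : V → Bool → ℤ := fun u b => if G.sign v u = some (xor true b) then 1 else 0
  have hd : ∀ u, d u false + d u true = G.ind v u := by
    intro u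
    unfold ind
    rcases hs : G.sign v u with _ | s
    · simp [d, hs]
    · cases s <;> simp [d, hs]
  obtain ⟨φ, hφ⟩ := h.colorable_of_ssubset (Finset.erase_ssubset hv) (d := d)
    (fun u b => by simp only [d]; split_ifs <;> simp) (fun Y hY hne => by
      have := h.pot_ge_nb hv hl hY hne
      rw [Finset.sum_congr rfl fun u _ => hd u]
      unfold nb at this
      linarith)
  have hA : A = insert v (A.erase v) := (Finset.insert_erase hv).symm
  have hn : v ∉ A.erase v := Finset.notMem_erase v A
  have hnb : G.nb v A = G.nb v (A.erase v) := by
    conv_lhs => rw [hA]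
    rw [G.nb_insert v hn, G.ind_self, zero_add]
  have hne : ∀ u ∈ A.erase v, u ≠ v := fun u hu => Finset.ne_of_mem_erase hu
  have hcl : G.clash φ true v (A.erase v) = ∑ u ∈ A.erase v, d u (φ u) := rfl
  have build : ∀ b, G.clash φ b v (A.erase v) ≤ cap v b →
      (∀ u ∈ A.erase v, (if G.sign v u = some (xor b (φ u)) then 1 else 0) ≤ d u (φ u)) →
      False := by
    intro b h1 h2
    apply h.not_colorable
    have e1 : ∀ u ∈ A.erase v, Function.update φ v b u = φ u := fun u hu =>
      Function.update_of_ne (hne u hu) ..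
    refine ⟨Function.update φ v b, fun u hu => ?_⟩
    rw [hA, G.con_insert _ u hn]
    by_cases huv : u = v
    · subst huv
      rw [G.conf_self, G.con_eq_clash (Function.update_self ..), G.clash_congr e1,
        Function.update_self]
      linarith
    · have hu' := Finset.mem_erase.2 ⟨huv, hu⟩
      rw [G.conf_comm, G.con_congr (e1 u hu') e1, e1 u hu']
      have a := hφ u hu'
      have b := h2 u hu'
      unfold conf
      rw [Function.update_self, e1 u hu']
      linarith
  have htrue : ¬ G.clash φ true v (A.erase v) ≤ cap v true := fun h' =>
    build true h' fun u _ => le_rfl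
  have hle := G.clash_le_nb φ true v (A.erase v)
  rw [hnb]
  refine ⟨by omega, fun ha => ?_⟩
  by_contra hlt
  have hsum := G.clash_add_clash φ v (A.erase v)
  have h0 := G.clash_nonneg φ false v (A.erase v)
  refine build false (by omega) fun u hu => ?_
  -- all neighbours clash with the rich node, so none clashes with the poor node
  have hz : G.clash φ false v (A.erase v) = 0 := by omega
  have := (Finset.sum_eq_zero_iff_of_nonneg (fun y _ => by split_ifs <;> simp)).1 hz u hu
  rw [this]
  simp only [d]; split_ifs <;> simp

/-- Two links are not adjacent: both could be coloured last. -/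
lemma ind_link_link (h : G.Obstruction i M cap A) {x y : V} (hx : x ∈ A) (hy : y ∈ A)
    (lx : G.IsLink i M cap A x) (ly : G.IsLink i M cap A y) : G.ind x y = 0 := by
  refine (G.ind_cases x y).resolve_right fun hxy => h.not_colorable ?_
  have hne : x ≠ y := by rintro rfl; rw [G.ind_self] at hxy; simp at hxy
  have hsub : ({x, y} : Finset V) ⊆ A := by
    intro z hz; rcases Finset.mem_insert.1 hz with rfl | hz
    · exact hx
    · rwa [Finset.mem_singleton.1 hz]
  set R := A \ {x, y} with hR
  obtain ⟨φ, hφ⟩ := h.ih R cap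
    (Finset.card_lt_card (Finset.sdiff_ssubset hsub (Finset.insert_nonempty _ _)))
    (h.bounded.mono Finset.sdiff_subset) (h.sparse.mono Finset.sdiff_subset)
  have hd : Disjoint R {x, y} := Finset.sdiff_disjoint
  have nbp : ∀ z, G.nb z {x, y} = G.ind z x + G.ind z y := fun z => by
    rw [G.nb_insert z (by simpa using hne), nb_singleton]
  have nbR : ∀ z ∈ ({x, y} : Finset V), G.nb z R ≤ 1 ∧ G.nb z {x, y} ≤ 1 ∧
      wt M cap z = 2 * i + 1 := by
    intro z hz
    have e := nb_sdiff_add (G := G) (z := z) hsub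
    rw [← hR] at e
    rcases Finset.mem_insert.1 hz with rfl | hz
    · rw [lx.2, nbp, G.ind_self] at e
      rw [nbp, G.ind_self, hxy]
      exact ⟨by omega, by norm_num, lx.1⟩
    · rw [Finset.mem_singleton.1 hz] at e ⊢
      rw [ly.2, nbp, G.ind_self, G.ind_comm, hxy] at e
      rw [nbp, G.ind_self, G.ind_comm, hxy]
      exact ⟨by omega, by norm_num, ly.1⟩
  obtain ⟨ψ, h1, h2⟩ := exists_extension φ hd fun z hz => (nbR z hz).1
  refine ⟨ψ, fun v hv => ?_⟩
  rw [← Finset.sdiff_union_of_subset hsub, G.con_union ψ v hd]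
  by_cases hvp : v ∈ ({x, y} : Finset V)
  · rw [h2 v hvp]
    have a := G.con_le_nb ψ v {x, y}
    have b := (nbR v hvp).2.1
    have := h.one_le_cap hv (nbR v hvp).2.2 (ψ v)
    linarith
  · have hvR : v ∈ R := Finset.mem_sdiff.2 ⟨hv, hvp⟩
    have : G.con ψ v {x, y} = 0 := Finset.sum_eq_zero fun z hz => by
      rw [G.conf_comm]
      exact (Finset.sum_eq_zero_iff_of_nonneg fun t _ => G.conf_nonneg ψ z t).1 (h2 z hz) v hvR
    rw [this, G.con_congr (h1 v hvR) h1, h1 v hvR, add_zero]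
    exact hφ v hvR

end Obstruction

end SignedGraph

/-! ### Potentials of sets that miss two vertices -/

namespace SignedGraph

variable {V : Type u} {G : SignedGraph V} {i M : ℤ} {cap : V → Bool → ℤ} {A : Finset V}
variable [DecidableEq V]

lemma con_eq_zero_of_nb {φ : V → Bool} {v : V} {T : Finset V} (h : G.nb v T = 0) :
    G.con φ v T = 0 := le_antisymm (h ▸ G.con_le_nb φ v T) (G.con_nonneg φ v T)

lemma sum_nb_comm (X Y : Finset V) : ∑ x ∈ X, G.nb x Y = ∑ y ∈ Y, G.nb y X := by
  unfold nb
  rw [Finset.sum_comm]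
  exact Finset.sum_congr rfl fun y _ => Finset.sum_congr rfl fun x _ => G.ind_comm x y

lemma ind_eq_zero_of_nb {v u : V} {T : Finset V} (h : G.nb v T = 0) (hu : u ∈ T) :
    G.ind v u = 0 :=
  (Finset.sum_eq_zero_iff_of_nonneg fun t _ => G.ind_nonneg v t).1 h u hu

lemma conf_eq_zero_of_con {φ : V → Bool} {v u : V} {T : Finset V} (h : G.con φ v T = 0)
    (hu : u ∈ T) : G.conf φ v u = 0 :=
  (Finset.sum_eq_zero_iff_of_nonneg fun t _ => G.conf_nonneg φ v t).1 h u hu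

namespace Obstruction

/-- The case in which some vertex `z` outside `T` that is not a link has a neighbour `t` in `T`.
Colour `T` with one unit of the capacity of `t` kept in reserve, for a conflict between `t` and the
rich node of `z`. If that conflict is possible, then `z` needs no forbidden colour; otherwise `z`
is coloured first in `A \ T`, with its rich node. -/
lemma pot_ne_of_boundary (h : G.Obstruction i M cap A) {T : Finset V} (hTA : T ⊆ A)
    (hne : T.Nonempty)
    (hnb : ∀ z ∈ A \ T, G.nb z T ≤ 1)
    (hext : ∀ Y ⊆ A \ T, Y ≠ A \ T → 0 ≤ G.pot i M cap Y - (i + 1) * ∑ y ∈ Y, G.nb y T)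
    (hall : -1 ≤ G.pot i M cap (A \ T) - (i + 1) * ∑ y ∈ A \ T, G.nb y T)
    (hcard : 2 ≤ (A \ T).card) {z : V} (hz : z ∈ A \ T) (hzT : G.nb z T = 1)
    (hl : ¬ G.IsLink i M cap A z) : False := by
  have hi := h.one_le
  have hM := h.le
  set Z := A \ T with hZ
  have hd : Disjoint T Z := Finset.disjoint_sdiff
  have hZA : Z ⊂ A := Finset.sdiff_ssubset hTA hne
  have hZne : Z.Nonempty := ⟨z, hz⟩
  have hTss : T ⊂ A := by
    refine hTA.ssubset_of_ne ?_
    rintro rfl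
    simp [hZ] at hz
  have hbZ : Bounded i M cap Z := h.bounded.mono hZA.1
  have hwle := hbZ.wt_le hz
  have hext' : ∀ Y ⊆ Z, -1 ≤ G.pot i M cap Y - (i + 1) * ∑ y ∈ Y, G.nb y T := fun Y hY => by
    by_cases hYZ : Y = Z
    · rw [hYZ]; exact hall
    · have := hext Y hY hYZ; linarith
  have hwz : i + 1 ≤ wt M cap z := by
    have := hext {z} (Finset.singleton_subset_iff.2 hz) (by
      intro h'; rw [← h'] at hcard; simp at hcard)
    simp only [pot_singleton, Finset.sum_singleton, hzT] at this
    linarith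
  have hcz := hbZ z hz
  obtain ⟨t, ht, hzt⟩ := exists_of_nb_pos (by rw [hzT]; norm_num : 0 < G.nb z T)
  obtain ⟨s, hs⟩ := Option.isSome_iff_exists.1 (ind_eq_one_iff.1 hzt)
  have honly : ∀ t' ∈ T, t' ≠ t → G.ind z t' = 0 := fun t' ht' hne' =>
    (G.ind_cases z t').resolve_right fun h1 => hne' (eq_of_nb_le_one hzT.le ht' ht h1 hzt)
  -- one unit of the capacity of `t` is kept in reserve for a conflict with the rich node of `z`
  let d : V → Bool → ℤ := fun v b => if v = t ∧ b = xor s true then 1 else 0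
  obtain ⟨φ, hφ⟩ := h.colorable_of_ssubset hTss (d := d)
    (fun v b => by simp only [d]; split_ifs <;> simp) (fun Y hY hYne => by
      have a := h.pot_ge_one (Finset.ssubset_of_subset_of_ssubset hY hTss) hYne
      have b : ∑ v ∈ Y, (d v false + d v true) ≤ 1 := by
        calc ∑ v ∈ Y, (d v false + d v true) = ∑ v ∈ Y, if v = t then 1 else 0 := by
              refine Finset.sum_congr rfl fun v _ => ?_
              by_cases hv : v = t
              · cases s <;> simp [d, hv]
              · simp [d, hv]
          _ ≤ 1 := by rw [Finset.sum_ite_eq']; split_ifs <;> simp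
      linarith)
  have hkf : ∀ Y, kills (G.forbid φ T) Y ≤ ∑ y ∈ Y, G.nb y T := kills_forbid_le φ T
  have hφ0 : ∀ v ∈ T, G.con φ v T ≤ cap v (φ v) := fun v hv => by
    have := hφ v hv
    have : 0 ≤ d v (φ v) := by simp only [d]; split_ifs <;> simp
    linarith
  by_cases hφt : φ t = xor s true
  · -- `z` may be rich, at the price of a conflict with `t`
    let kill : V → Option Bool := fun v => if v = z then none else G.forbid φ T v
    let e : V → Bool → ℤ := fun v b => if v = z ∧ b = true then 1 else 0
    have he : ∀ v b, 0 ≤ e v b := fun v b => by simp only [e]; split_ifs <;> simp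
    obtain ⟨χ, hχ⟩ := h.ih.colorableAvoiding (by omega) (by omega) Z
      (fun v b => cap v b - e v b) kill (Finset.card_lt_card hZA) (hbZ.sub he) (fun Y hY => by
        rw [G.pot_sub e]
        have hsum : ∑ v ∈ Y, (e v false + e v true) = if z ∈ Y then 1 else 0 := by
          rw [← Finset.sum_ite_eq' Y z fun _ => (1 : ℤ)]
          refine Finset.sum_congr rfl fun v _ => ?_
          by_cases hv : v = z <;> simp [e, hv]
        rw [hsum]
        by_cases hzY : z ∈ Y
        · rw [if_pos hzY]
          have a := hext' Y hY
          have b : kills kill Y ≤ ∑ y ∈ Y, G.nb y T - 1 := by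
            have hn := Finset.notMem_erase z Y
            rw [← Finset.insert_erase hzY, kills_insert hn, Finset.sum_insert hn, hzT]
            have c1 : kills kill (Y.erase z) = kills (G.forbid φ T) (Y.erase z) :=
              Finset.sum_congr rfl fun v hv => by
                simp only [kill, if_neg (Finset.ne_of_mem_erase hv)]
            have c2 := hkf (Y.erase z)
            rw [c1]
            simp only [kill, if_true, Option.isSome_none]
            simp only [Bool.false_eq_true, if_false]
            linarith
          have := mul_le_mul_of_nonneg_left b (by omega : 0 ≤ i + 1)
          linarith
        · rw [if_neg hzY]
          have a := hext Y hY (by rintro rfl; exact hzY hz)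
          have c1 : kills kill Y = kills (G.forbid φ T) Y :=
            Finset.sum_congr rfl fun v hv => by
              have : v ≠ z := by rintro rfl; exact hzY hv
              simp only [kill, if_neg this]
          have := mul_le_mul_of_nonneg_left (hkf Y) (by omega : 0 ≤ i + 1)
          rw [c1]
          linarith)
    obtain ⟨ψ, h1, h2⟩ := exists_glue T φ χ
    have h2' : ∀ y ∈ Z, ψ y = χ y := fun y hy => h2 y (Finset.disjoint_right.1 hd hy)
    have hc : ∀ y ∈ Z, y ≠ z → ∀ t ∈ T, G.conf ψ y t = 0 := by
      intro y hy hyz t ht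
      refine if_neg ?_
      rw [h2' y hy, h1 t ht]
      refine sign_ne_of_forbid_ne (hnb y hy) ?_ ht
      have := (hχ y hy).2
      simpa only [kill, if_neg hyz] using this
    have hczt : G.conf ψ z t ≤ e z (χ z) := by
      unfold conf
      rw [h2' z hz, h1 t ht, hs, hφt]
      simp only [e]
      cases s <;> cases χ z <;> simp
    refine h.not_colorable ⟨ψ, fun v hv => ?_⟩
    rw [← Finset.union_sdiff_of_subset hTA, ← hZ, G.con_union ψ v hd]
    by_cases hvT : v ∈ T
    · rw [G.con_congr (h1 v hvT) h1, h1 v hvT]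
      have hle : G.con ψ v Z ≤ d v (φ v) := by
        have : G.con ψ v Z = G.conf ψ v z := by
          refine Finset.sum_eq_single_of_mem z hz fun y hy hyz => ?_
          rw [G.conf_comm]; exact hc y hy hyz v hvT
        rw [this]
        by_cases hvt : v = t
        · subst hvt
          simp only [d, hφt, and_self, if_true]
          exact (G.conf_le_ind _ _ _).trans (G.ind_le_one _ _)
        · rw [G.conf_comm, G.conf_eq_zero_of_ind (honly v hvT hvt)]
          simp only [d, hvt, false_and, if_false, le_refl]
      linarith [hφ v hvT]
    · have hvZ : v ∈ Z := Finset.mem_sdiff.2 ⟨hv, hvT⟩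
      rw [G.con_congr (h2' v hvZ) h2', h2' v hvZ]
      have a := (hχ v hvZ).1
      dsimp only at a
      have hle : G.con ψ v T ≤ e v (χ v) := by
        by_cases hvz : v = z
        · subst hvz
          have : G.con ψ v T = G.conf ψ v t :=
            Finset.sum_eq_single_of_mem t ht fun y hy hyt =>
              G.conf_eq_zero_of_ind (honly y hy hyt)
          rw [this]; exact hczt
        · have : G.con ψ v T = 0 := Finset.sum_eq_zero fun y hy => hc v hvZ hvz y hy
          rw [this]; exact he _ _
      linarith
  · -- `z` can be made rich without a conflict with `t`
    have hfz : G.forbid φ T z ≠ some true := by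
      rw [forbid_eq hzT.le ht hs]
      revert hφt
      cases s <;> cases φ t <;> simp
    have key : ∀ Y ⊆ Z.erase z, (insert z Y ⊆ Z) ∧
        G.pot i M cap (insert z Y) - (i + 1) * ∑ y ∈ insert z Y, G.nb y T
        = G.pot i M cap Y - (i + 1) * ∑ y ∈ Y, G.nb y T - (i + 1) * G.nb z Y
          + wt M cap z - (i + 1) := by
      intro Y hY
      have hzY : z ∉ Y := fun h' => Finset.notMem_erase z Z (hY h')
      refine ⟨Finset.insert_subset hz (hY.trans (Finset.erase_subset _ _)), ?_⟩
      rw [G.pot_insert hzY, Finset.sum_insert hzY, hzT]; ring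
    obtain ⟨χ, hχ⟩ := colorableAvoiding_of_forced (G := G) (M := M) (cap := cap)
      (kill := G.forbid φ T) (by omega : 0 ≤ i) hz true hfz hbZ (fun Y hY => by
        have hm := mul_le_mul_of_nonneg_left (hkf Y) (by omega : 0 ≤ i + 1)
        have hYZ : Y ⊆ Z := hY.trans (Finset.erase_subset _ _)
        have hzY : z ∉ Y := fun h' => Finset.notMem_erase z Z (hY h')
        obtain ⟨k1, k2⟩ := key Y hY
        rcases (G.nb_nonneg z Y).eq_or_lt with h0 | h0
        · rw [← h0]
          have := hext Y hYZ (by rintro rfl; exact hzY hz)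
          linarith
        · by_cases heq : insert z Y = Z
          · have a := hext' _ k1
            have b : wt M cap z < 2 * i + 1 ∨ 2 ≤ G.nb z Y := by
              by_contra hcon
              push Not at hcon
              refine hl ⟨by omega, ?_⟩
              rw [← nb_sdiff_add hTA, ← hZ, ← heq, G.nb_insert z hzY, G.ind_self, hzT]
              omega
            have c : 1 ≤ i * (G.nb z Y - 1) + (2 * i + 1 - wt M cap z) := by
              rcases b with b | b
              · have : 0 ≤ i * (G.nb z Y - 1) := mul_nonneg (by omega) (by omega)
                omega
              · have : i * 1 ≤ i * (G.nb z Y - 1) :=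
                  mul_le_mul_of_nonneg_left (by omega) (by omega)
                omega
            linarith
          · have a := hext _ k1 heq
            have : 0 ≤ i * (G.nb z Y - 1) := mul_nonneg (by omega) (by omega)
            linarith)
      (fun Y hY => by
        have hm := mul_le_mul_of_nonneg_left (hkf Y) (by omega : 0 ≤ i + 1)
        obtain ⟨k1, k2⟩ := key Y hY
        have a := hext' _ k1
        have : wt M cap z - i ≤ cap z true := by unfold wt; linarith
        linarith)
      (fun cap' kill' hb' hp' => h.ih.colorableAvoiding (by omega) (by omega) _ cap' kill'
        ((Finset.card_le_card (Finset.erase_subset _ _)).trans_lt (Finset.card_lt_card hZA))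
        hb' hp')
    obtain ⟨ψ, h1, h2⟩ := exists_glue T φ χ
    have h2' : ∀ y ∈ Z, ψ y = χ y := fun y hy => h2 y (Finset.disjoint_right.1 hd hy)
    have hc : ∀ y ∈ Z, ∀ t ∈ T, G.conf ψ y t = 0 := by
      intro y hy t ht
      refine if_neg ?_
      rw [h2' y hy, h1 t ht]
      exact sign_ne_of_forbid_ne (hnb y hy) (hχ y hy).2 ht
    refine h.not_colorable ⟨ψ, fun v hv => ?_⟩
    rw [← Finset.union_sdiff_of_subset hTA, ← hZ, G.con_union ψ v hd]
    by_cases hvT : v ∈ T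
    · have : G.con ψ v Z = 0 :=
        Finset.sum_eq_zero fun y hy => by rw [G.conf_comm]; exact hc y hy v hvT
      rw [this, G.con_congr (h1 v hvT) h1, h1 v hvT, add_zero]
      exact hφ0 v hvT
    · have hvZ : v ∈ Z := Finset.mem_sdiff.2 ⟨hv, hvT⟩
      have : G.con ψ v T = 0 := Finset.sum_eq_zero fun y hy => hc v hvZ y hy
      rw [this, G.con_congr (h2' v hvZ) h2', h2' v hvZ, zero_add]
      exact (hχ v hvZ).1

/-- The case in which all vertices outside `T` with a neighbour in `T` are links. They are coloured
without conflicts with `T`; each of them may then be in conflict with its second neighbour, whose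
capacity is lowered accordingly. -/
lemma pot_ne_of_links (h : G.Obstruction i M cap A) {T : Finset V} (hTA : T ⊂ A)
    (hne : T.Nonempty)
    (hnb : ∀ z ∈ A \ T, G.nb z T ≤ 1)
    (hext : ∀ Y ⊆ A \ T, -1 ≤ G.pot i M cap Y - (i + 1) * ∑ y ∈ Y, G.nb y T)
    (hl : ∀ z ∈ A \ T, G.nb z T = 1 → G.IsLink i M cap A z) : False := by
  classical
  have hi := h.one_le
  have hM := h.le
  set Z := A \ T with hZ
  have hd : Disjoint T Z := Finset.disjoint_sdiff
  have hZA : Z ⊂ A := Finset.sdiff_ssubset hTA.1 hne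
  set B := Z.filter fun z => G.nb z T = 1 with hB
  set Z' := Z.filter fun z => ¬ G.nb z T = 1 with hZ'
  have hBZ : B ∪ Z' = Z := Finset.filter_union_filter_not_eq _ _
  have hdB : Disjoint B Z' := Finset.disjoint_filter_filter_not _ _ _
  have hBsub : B ⊆ Z := Finset.filter_subset _ _
  have hZsub : Z' ⊆ Z := Finset.filter_subset _ _
  have hBm : ∀ x ∈ B, x ∈ A ∧ G.nb x T = 1 ∧ G.IsLink i M cap A x := fun x hx => by
    obtain ⟨a, b⟩ := Finset.mem_filter.1 hx
    exact ⟨hZA.1 a, b, hl x a b⟩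
  have hZ0 : ∀ y ∈ Z', G.nb y T = 0 := fun y hy => by
    obtain ⟨a, b⟩ := Finset.mem_filter.1 hy
    have := hnb y a
    have := G.nb_nonneg y T
    omega
  have hBB : ∀ x ∈ B, G.nb x B = 0 := fun x hx => Finset.sum_eq_zero fun y hy =>
    h.ind_link_link (hBm x hx).1 (hBm y hy).1 (hBm x hx).2.2 (hBm y hy).2.2
  have hBZ' : ∀ x ∈ B, G.nb x Z' = 1 := fun x hx => by
    have a := nb_sdiff_add (G := G) (z := x) hTA.1
    rw [← hZ, ← hBZ, G.nb_union x hdB, hBB x hx, (hBm x hx).2.1, (hBm x hx).2.2.2] at a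
    omega
  obtain ⟨φ, hφ⟩ := h.ih T cap (Finset.card_lt_card hTA) (h.bounded.mono hTA.1)
    (h.sparse.mono hTA.1)
  obtain ⟨ψ₀, p1, p2⟩ := exists_extension φ (Finset.disjoint_of_subset_right hBsub hd)
    fun z hz => (hBm z hz).2.1.le
  obtain ⟨χ, hχ⟩ := h.colorable_of_ssubset (Finset.ssubset_of_subset_of_ssubset hZsub hZA)
    (d := fun y b => G.clash ψ₀ b y B) (fun y b => G.clash_nonneg ψ₀ b y B)
    (fun Y hY hYne => by
      have e1 : ∑ v ∈ Y, (G.clash ψ₀ false v B + G.clash ψ₀ true v B) = ∑ v ∈ Y, G.nb v B :=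
        Finset.sum_congr rfl fun v _ => G.clash_add_clash ψ₀ v B
      rw [e1]
      set BY := B.filter fun x => G.nb x Y = 1 with hBY
      have hBYB : BY ⊆ B := Finset.filter_subset _ _
      have hdY : Disjoint Y BY :=
        (Finset.disjoint_of_subset_left hY (Finset.disjoint_of_subset_right hBYB hdB.symm))
      have a := hext (Y ∪ BY) (Finset.union_subset (hY.trans hZsub) (hBYB.trans hBsub))
      have nbY : ∀ x ∈ B, G.nb x Y = if G.nb x Y = 1 then 1 else 0 := fun x hx => by
        have := G.nb_mono x hY
        rw [hBZ' x hx] at this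
        have := G.nb_nonneg x Y
        split_ifs <;> omega
      have b1 : ∑ v ∈ Y, G.nb v B = BY.card := by
        rw [sum_nb_comm, Finset.sum_congr rfl nbY, Finset.card_filter]; push_cast; rfl
      have b2 : ∑ x ∈ BY, G.nb x Y = BY.card := by
        rw [Finset.sum_congr rfl fun x hx => (Finset.mem_filter.1 hx).2]; simp; rfl
      have b3 : ∑ x ∈ BY, G.nb x T = BY.card := by
        rw [Finset.sum_congr rfl fun x hx => (hBm x (hBYB hx)).2.1]; simp
      have b4 : ∑ y ∈ Y, G.nb y T = 0 := Finset.sum_eq_zero fun y hy => hZ0 y (hY hy)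
      have b5 : G.pot i M cap BY = (2 * i + 1) * BY.card := by
        have c1 : G.edges BY = 0 := by
          have := G.two_mul_edges BY
          rw [Finset.sum_eq_zero fun x hx => le_antisymm
            ((G.nb_mono x hBYB).trans (hBB x (hBYB hx)).le) (G.nb_nonneg x BY)] at this
          omega
        unfold pot
        rw [c1, Finset.sum_congr rfl fun x hx => (hBm x (hBYB hx)).2.2.1, Finset.sum_const]
        simp; ring
      rw [G.pot_union hdY, b5, b2, Finset.sum_union hdY, b3, b4] at a
      rw [b1]
      linarith)
  obtain ⟨ψ, h1, h2⟩ := exists_glue (T ∪ B) ψ₀ χ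
  have hT : ∀ t ∈ T, ψ t = φ t := fun t ht => by
    rw [h1 t (Finset.mem_union_left _ ht), p1 t ht]
  have hT' : ∀ t ∈ T, ψ t = ψ₀ t := fun t ht => h1 t (Finset.mem_union_left _ ht)
  have hB' : ∀ t ∈ B, ψ t = ψ₀ t := fun t ht => h1 t (Finset.mem_union_right _ ht)
  have hZχ : ∀ t ∈ Z', ψ t = χ t := fun t ht => h2 t (by
    rw [Finset.mem_union, not_or]
    exact ⟨Finset.disjoint_right.1 hd (hZsub ht), Finset.disjoint_right.1 hdB ht⟩)
  have cBT : ∀ x ∈ B, G.con ψ x T = 0 := fun x hx => by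
    rw [G.con_congr (hB' x hx) hT']; exact p2 x hx
  refine h.not_colorable ⟨ψ, fun v hv => ?_⟩
  have hdZ := hd
  rw [← hBZ] at hdZ
  rw [← Finset.union_sdiff_of_subset hTA.1, ← hZ, ← hBZ, G.con_union ψ v hdZ, G.con_union ψ v hdB]
  by_cases hvT : v ∈ T
  · have e1 : G.con ψ v B = 0 := Finset.sum_eq_zero fun x hx => by
      rw [G.conf_comm]; exact conf_eq_zero_of_con (cBT x hx) hvT
    have e2 : G.con ψ v Z' = 0 := Finset.sum_eq_zero fun y hy => by
      rw [G.conf_comm]; exact G.conf_eq_zero_of_ind (ind_eq_zero_of_nb (hZ0 y hy) hvT)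
    rw [e1, e2, G.con_congr (hT v hvT) hT, hT v hvT]
    have := hφ v hvT
    linarith
  · have hvZ : v ∈ Z := Finset.mem_sdiff.2 ⟨hv, hvT⟩
    by_cases hvB : v ∈ B
    · rw [cBT v hvB, con_eq_zero_of_nb (hBB v hvB)]
      have a := G.con_le_nb ψ v Z'
      rw [hBZ' v hvB] at a
      have := h.one_le_cap hv (hBm v hvB).2.2.1 (ψ v)
      linarith
    · have hvZ' : v ∈ Z' := by
        rw [← hBZ, Finset.mem_union] at hvZ
        exact hvZ.resolve_left hvB
      rw [con_eq_zero_of_nb (hZ0 v hvZ'), G.con_congr (hZχ v hvZ') hZχ,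
        G.con_eq_clash (hZχ v hvZ'), G.clash_congr hB', hZχ v hvZ']
      have := hχ v hvZ'
      linarith

/-- Sets that miss at least two vertices have potential at least `2 - M`. -/
lemma pot_ge_two (h : G.Obstruction i M cap A) {T : Finset V} (hTA : T ⊆ A) (hne : T.Nonempty)
    (hcard : 2 ≤ (A \ T).card) : 2 - M ≤ G.pot i M cap T := by
  have hi := h.one_le
  by_contra hlt
  have hZne : (A \ T).Nonempty := Finset.card_pos.1 (by omega)
  have hTss : T ⊂ A := by
    refine hTA.ssubset_of_ne ?_
    rintro rfl
    simp at hZne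
  have hpot : G.pot i M cap T = 1 - M := by
    have := h.pot_ge_one hTss hne
    omega
  have hd : Disjoint T (A \ T) := Finset.disjoint_sdiff
  have hU : ∀ Y ⊆ A \ T, T ∪ Y ⊆ A := fun Y hY =>
    Finset.union_subset hTA (hY.trans Finset.sdiff_subset)
  have hpU : ∀ Y ⊆ A \ T, G.pot i M cap (T ∪ Y)
      = 1 - M + (G.pot i M cap Y - (i + 1) * ∑ y ∈ Y, G.nb y T) := fun Y hY => by
    rw [G.pot_union (Finset.disjoint_of_subset_right hY hd), hpot]; ring
  have hneU : ∀ Y, (T ∪ Y).Nonempty := fun Y => hne.mono Finset.subset_union_left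
  have hext : ∀ Y ⊆ A \ T, Y ≠ A \ T →
      0 ≤ G.pot i M cap Y - (i + 1) * ∑ y ∈ Y, G.nb y T := fun Y hY hYne => by
    have hss : T ∪ Y ⊂ A := (hU Y hY).ssubset_of_ne fun heq => hYne <|
      hY.antisymm fun z hz => by
        obtain ⟨a, b⟩ := Finset.mem_sdiff.1 hz
        rw [← heq] at a
        exact (Finset.mem_union.1 a).resolve_left b
    have := h.pot_ge_one hss (hneU Y)
    rw [hpU Y hY] at this
    linarith
  have hext' : ∀ Y ⊆ A \ T, -1 ≤ G.pot i M cap Y - (i + 1) * ∑ y ∈ Y, G.nb y T := fun Y hY => by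
    have := h.sparse _ (hU Y hY) (hneU Y)
    rw [hpU Y hY] at this
    linarith
  have hnb : ∀ z ∈ A \ T, G.nb z T ≤ 1 := by
    intro z hz
    have a := hext {z} (Finset.singleton_subset_iff.2 hz) (by
      intro h'; rw [← h'] at hcard; simp at hcard)
    simp only [pot_singleton, Finset.sum_singleton] at a
    have b := h.bounded.wt_le (Finset.mem_sdiff.1 hz).1
    by_contra hlt
    have : (i + 1) * 2 ≤ (i + 1) * G.nb z T := mul_le_mul_of_nonneg_left (by omega) (by omega)
    linarith
  by_cases hB : ∀ z ∈ A \ T, G.nb z T = 1 → G.IsLink i M cap A z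
  · exact h.pot_ne_of_links hTss hne hnb hext' hB
  · push Not at hB
    obtain ⟨z, hz, hzT, hl⟩ := hB
    exact h.pot_ne_of_boundary hTA hne hnb hext (hext' _ subset_rfl) hcard hz hzT hl

end Obstruction

end SignedGraph

/-! ### The surplus of core vertices -/

namespace SignedGraph

variable {V : Type u} {G : SignedGraph V} {i M : ℤ} {cap : V → Bool → ℤ} {A : Finset V}

open Classical in
/-- The set of links of `A`. -/
noncomputable def links (G : SignedGraph V) (i M : ℤ) (cap : V → Bool → ℤ) (A : Finset V) :
    Finset V := A.filter fun v => G.IsLink i M cap A v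

open Classical in
/-- The set of vertices of `A` that are not links. -/
noncomputable def core (G : SignedGraph V) (i M : ℤ) (cap : V → Bool → ℤ) (A : Finset V) :
    Finset V := A.filter fun v => ¬ G.IsLink i M cap A v

lemma mem_links {v : V} : v ∈ G.links i M cap A ↔ v ∈ A ∧ G.IsLink i M cap A v := by
  simp [links]

lemma mem_core {v : V} : v ∈ G.core i M cap A ↔ v ∈ A ∧ ¬ G.IsLink i M cap A v := by
  simp [core]

variable [DecidableEq V]

lemma core_union_links : G.core i M cap A ∪ G.links i M cap A = A := by
  ext v; simp only [Finset.mem_union, mem_core, mem_links]; tauto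

lemma disjoint_core_links : Disjoint (G.core i M cap A) (G.links i M cap A) := by
  rw [Finset.disjoint_left]; intro v; rw [mem_core, mem_links]; tauto

lemma nb_core_add_links (v : V) :
    G.nb v (G.core i M cap A) + G.nb v (G.links i M cap A) = G.nb v A := by
  rw [← G.nb_union v disjoint_core_links, core_union_links]

/-- The neighbours of `v` in `X`. -/
def nbrs (G : SignedGraph V) (v : V) (X : Finset V) : Finset V := X.filter fun x => G.ind v x = 1

lemma mem_nbrs {v x : V} {X : Finset V} : x ∈ G.nbrs v X ↔ x ∈ X ∧ G.ind v x = 1 := by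
  simp [nbrs]

lemma card_nbrs (v : V) (X : Finset V) : ((G.nbrs v X).card : ℤ) = G.nb v X := by
  unfold nbrs nb
  rw [Finset.card_filter]; push_cast
  refine Finset.sum_congr rfl fun x _ => ?_
  rcases G.ind_cases v x with h | h <;> simp [h]

lemma nb_nbrs (v : V) (X : Finset V) : G.nb v (G.nbrs v X) = G.nb v X := by
  rw [← card_nbrs, ← card_nbrs]
  congr 2
  ext x; simp [mem_nbrs]

namespace Obstruction

/-- A link adjacent to `v` has exactly one neighbour besides `v`, and that neighbour is not a
link. -/
lemma link_nbr (h : G.Obstruction i M cap A) {v x : V} (hv : v ∈ A)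
    (hx : x ∈ G.nbrs v (G.links i M cap A)) :
    x ∈ A ∧ G.IsLink i M cap A x ∧ G.nb x (G.links i M cap A) = 0 ∧
    G.nb x (A \ insert v (G.nbrs v (G.links i M cap A))) = 1 ∧ x ≠ v := by
  obtain ⟨h1, h2⟩ := mem_nbrs.1 hx
  obtain ⟨h3, h4⟩ := mem_links.1 h1
  have h5 : G.nb x (G.links i M cap A) = 0 := Finset.sum_eq_zero fun y hy =>
    h.ind_link_link h3 (mem_links.1 hy).1 h4 (mem_links.1 hy).2
  have hxv : x ≠ v := by rintro rfl; rw [G.ind_self] at h2; simp at h2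
  have hsub : insert v (G.nbrs v (G.links i M cap A)) ⊆ A := Finset.insert_subset hv
    fun y hy => (mem_links.1 (mem_nbrs.1 hy).1).1
  have hvn : v ∉ G.nbrs v (G.links i M cap A) := fun hv' => by
    have := (mem_nbrs.1 hv').2
    rw [G.ind_self] at this; simp at this
  have h6 : G.nb x (G.nbrs v (G.links i M cap A)) = 0 :=
    le_antisymm ((G.nb_mono x (Finset.filter_subset _ _)).trans h5.le) (G.nb_nonneg _ _)
  have e := nb_sdiff_add (G := G) (z := x) hsub
  rw [G.nb_insert x hvn, h6, G.ind_comm, h2, h4.2] at e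
  exact ⟨h3, h4, h5, by omega, hxv⟩

/-- Delete `v` and the links at `v`, and colour the rest `R` with capacities lowered by one for each
neighbour of `v` and for each outer end of a link in `S`. The links outside `S` are then coloured
without a conflict at their outer end, `v` gets a colour with few conflicts, and the links in `S`
are coloured without a conflict with `v`. -/
lemma peel (h : G.Obstruction i M cap A) {v : V} (hv : v ∈ A) {S R : Finset V}
    (hS : S ⊆ G.nbrs v (G.links i M cap A))
    (hR : R = A \ insert v (G.nbrs v (G.links i M cap A)))
    (hcnt : G.nb v R + G.nb v (G.links i M cap A) - S.card ≤ cap v false + cap v true + 1)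
    (hpot : ∀ T ⊆ R, T.Nonempty → -M ≤ G.pot i M cap T - 2 * (G.nb v T + ∑ x ∈ S, G.nb x T)) :
    False := by
  classical
  set X := G.nbrs v (G.links i M cap A) with hX
  have hXl : ∀ x ∈ X, x ∈ A ∧ G.IsLink i M cap A x ∧ G.nb x (G.links i M cap A) = 0 ∧
    G.nb x R = 1 ∧ x ≠ v := fun x hx => by rw [hR]; exact h.link_nbr hv hx
  have hXX : X ⊆ G.links i M cap A := Finset.filter_subset _ _
  have hsub : insert v X ⊆ A := Finset.insert_subset hv fun x hx => (hXl x hx).1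
  have hvX : v ∉ X := fun hv' => (hXl v hv').2.2.2.2 rfl
  have hRss : R ⊂ A := hR ▸ Finset.sdiff_ssubset hsub (Finset.insert_nonempty _ _)
  have hvR : v ∉ R := by rw [hR]; simp
  have hRX : Disjoint R X := by
    rw [hR]; exact Finset.disjoint_of_subset_right (Finset.subset_insert _ _) Finset.sdiff_disjoint
  let d : V → Bool → ℤ := fun u _ => G.ind v u + G.nb u S
  obtain ⟨φ, hφ⟩ := h.colorable_of_ssubset hRss (d := d)
    (fun u b => add_nonneg (G.ind_nonneg v u) (G.nb_nonneg u S)) (fun Y hY hne => by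
      have a := hpot Y hY hne
      rw [sum_nb_comm] at a
      have : ∑ u ∈ Y, (d u false + d u true) = 2 * (G.nb v Y + ∑ y ∈ Y, G.nb y S) := by
        unfold nb
        rw [← Finset.sum_add_distrib, Finset.mul_sum]
        refine Finset.sum_congr rfl fun u _ => ?_
        simp only [d, nb]; ring
      rw [this]; exact a)
  set X' := X \ S with hX'
  have hX'X : X' ⊆ X := Finset.sdiff_subset
  obtain ⟨ψ₀, p1, p2⟩ := exists_extension φ (Finset.disjoint_of_subset_right hX'X hRX)
    fun x hx => (hXl x (hX'X hx)).2.2.2.1.le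
  -- one of the two colours of `v` has few conflicts with the vertices coloured so far
  obtain ⟨β, hβ⟩ : ∃ β, G.clash ψ₀ β v (R ∪ X') ≤ cap v β := by
    by_contra hcon
    push Not at hcon
    have c1 := hcon false
    have c2 := hcon true
    have c3 := G.clash_add_clash ψ₀ v (R ∪ X')
    rw [G.nb_union v (Finset.disjoint_of_subset_right hX'X hRX)] at c3
    have c4 := nb_sdiff_add (G := G) (z := v) hS
    have c5 : G.nb v S = S.card := by
      unfold nb
      rw [Finset.sum_congr rfl fun x hx => (mem_nbrs.1 (hS hx)).2]; simp
    rw [hX, nb_nbrs, ← hX, ← hX'] at c4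
    omega
  obtain ⟨χ, q1, q2⟩ := exists_extension (T := {v}) (Z := S) (Function.update ψ₀ v β)
    (by rw [Finset.disjoint_singleton_left]; exact fun hv' => hvX (hS hv'))
    (fun x _ => by rw [nb_singleton]; exact G.ind_le_one x v)
  obtain ⟨ψ, r1, r2⟩ := exists_glue (insert v S) χ ψ₀
  have ev : ψ v = β := by
    rw [r1 v (Finset.mem_insert_self _ _), q1 v (Finset.mem_singleton_self _),
      Function.update_self]
  have eS : ∀ x ∈ S, ψ x = χ x := fun x hx => r1 x (Finset.mem_insert_of_mem hx)
  have eX' : ∀ x ∈ X', ψ x = ψ₀ x := fun x hx => r2 x (by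
    rw [Finset.mem_insert, not_or]
    exact ⟨fun h' => hvX (h' ▸ hX'X hx), (Finset.mem_sdiff.1 hx).2⟩)
  have eR0 : ∀ x ∈ R, ψ x = ψ₀ x := fun x hx => r2 x (by
    rw [Finset.mem_insert, not_or]
    exact ⟨fun h' => hvR (h' ▸ hx), fun h' => Finset.disjoint_left.1 hRX hx (hS h')⟩)
  have eR : ∀ x ∈ R, ψ x = φ x := fun x hx => (eR0 x hx).trans (p1 x hx)
  have eRX : ∀ x ∈ R ∪ X', ψ x = ψ₀ x := fun x hx =>
    (Finset.mem_union.1 hx).elim (eR0 x) (eX' x)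
  have cX'R : ∀ x ∈ X', G.con ψ x R = 0 := fun x hx => by
    rw [G.con_congr (eX' x hx) eR0]; exact p2 x hx
  have cSv : ∀ x ∈ S, G.conf ψ x v = 0 := fun x hx => by
    have := q2 x hx
    rw [con_singleton] at this
    rw [G.conf_congr (eS x hx) (r1 v (Finset.mem_insert_self _ _)), this]
  have cXX : ∀ x ∈ X, ∀ Y ⊆ X, G.con ψ x Y = 0 := fun x hx Y hY => con_eq_zero_of_nb <|
    le_antisymm ((G.nb_mono x (hY.trans hXX)).trans (hXl x hx).2.2.1.le) (G.nb_nonneg _ _)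
  have hd1 : Disjoint R X' := Finset.disjoint_of_subset_right hX'X hRX
  have hd2 : Disjoint (R ∪ X') S := by
    rw [Finset.disjoint_union_left]
    exact ⟨Finset.disjoint_of_subset_right hS hRX, Finset.sdiff_disjoint⟩
  have hX'S : X' ∪ S = X := Finset.sdiff_union_of_subset hS
  have hA : A = insert v ((R ∪ X') ∪ S) := by
    rw [Finset.union_assoc, hX'S, Finset.union_comm, ← Finset.insert_union, hR,
      Finset.union_sdiff_of_subset hsub]
  have hvn : v ∉ (R ∪ X') ∪ S := by
    rw [Finset.union_assoc, hX'S, Finset.mem_union, not_or]; exact ⟨hvR, hvX⟩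
  refine h.not_colorable ⟨ψ, fun u hu => ?_⟩
  have split : G.con ψ u A = G.conf ψ u v + (G.con ψ u R + G.con ψ u X') + G.con ψ u S := by
    conv_lhs => rw [hA]
    rw [G.con_insert ψ u hvn, G.con_union ψ u hd2, G.con_union ψ u hd1]; ring
  by_cases huv : u = v
  · subst huv
    have : G.con ψ u S = 0 := Finset.sum_eq_zero fun x hx => by
      rw [G.conf_comm]; exact cSv x hx
    rw [split, G.conf_self, this, ← G.con_union ψ u hd1, G.con_eq_clash ev,
      G.clash_congr eRX, ev]
    linarith
  by_cases huX : u ∈ X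
  · rw [split, cXX u huX X' hX'X, cXX u huX S hS]
    have hcap := h.one_le_cap hu (hXl u huX).2.1.1 (ψ u)
    by_cases huS : u ∈ S
    · rw [cSv u huS]
      have a := G.con_le_nb ψ u R
      rw [(hXl u huX).2.2.2.1] at a
      linarith
    · rw [cX'R u (Finset.mem_sdiff.2 ⟨huX, huS⟩)]
      have := (G.conf_le_ind ψ u v).trans (G.ind_le_one u v)
      linarith
  · have huR : u ∈ R := by
      rw [hR, Finset.mem_sdiff, Finset.mem_insert, not_or]; exact ⟨hu, huv, huX⟩
    have e1 : G.con ψ u X' = 0 := Finset.sum_eq_zero fun x hx => by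
      rw [G.conf_comm]; exact conf_eq_zero_of_con (cX'R x hx) huR
    have e2 := G.con_le_nb ψ u S
    have e3 := G.conf_le_ind ψ u v
    have e4 := hφ u huR
    rw [split, e1, G.con_congr (eR u huR) eR, eR u huR]
    rw [G.ind_comm] at e3
    simp only [d] at e4
    linarith

/-- A union-closed family that satisfies each of finitely many monotone requirements has a member
that satisfies all of them. -/
lemma exists_union {X T₀ : Finset V} {P : V → Finset V → Prop}
    {Q : Finset V → Prop}
    (h0 : Q T₀) (hQ : ∀ S T, Q S → Q T → Q (S ∪ T))
    (hP : ∀ x S T, S ⊆ T → P x S → P x T) (hX : ∀ x ∈ X, ∃ T, Q T ∧ P x T) :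
    ∃ T, Q T ∧ ∀ x ∈ X, P x T := by
  induction X using Finset.induction_on with
  | empty => exact ⟨T₀, h0, by simp⟩
  | insert x X hx ih =>
    obtain ⟨T, a, b⟩ := ih fun y hy => hX y (Finset.mem_insert_of_mem hy)
    obtain ⟨T', a', b'⟩ := hX x (Finset.mem_insert_self _ _)
    refine ⟨T ∪ T', hQ _ _ a a', fun y hy => ?_⟩
    rcases Finset.mem_insert.1 hy with rfl | hy
    · exact hP _ _ _ Finset.subset_union_right b'
    · exact hP _ _ _ Finset.subset_union_left (b y hy)

/-- For `i = M = 2` no vertex of full weight has nine links and no other neighbours. Some two of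
the nine links are such that no set of potential at most one contains both of their outer ends, and
`peel` applies to these two. Otherwise, by submodularity, one set of potential at most one would
contain the outer ends of all nine links. -/
lemma nine_links (h : G.Obstruction 2 2 cap A) {v : V} (hv : v ∈ A)
    (hw : wt 2 cap v = 5) (hm : G.nb v (G.core 2 2 cap A) = 0)
    (hn : G.nb v (G.links 2 2 cap A) = 9) : False := by
  classical
  set X := G.nbrs v (G.links 2 2 cap A) with hX
  set R := A \ insert v X with hR
  have hXl : ∀ x ∈ X, x ∈ A ∧ G.IsLink 2 2 cap A x ∧ G.nb x (G.links 2 2 cap A) = 0 ∧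
    G.nb x R = 1 ∧ x ≠ v := fun x hx => h.link_nbr hv hx
  have hXX : X ⊆ G.links 2 2 cap A := Finset.filter_subset _ _
  have hvX : v ∉ X := fun hv' => (hXl v hv').2.2.2.2 rfl
  have hXc : X.card = 9 := by
    have := card_nbrs (G := G) v (G.links 2 2 cap A)
    rw [hn] at this; exact_mod_cast this
  have hsub : insert v X ⊆ A := Finset.insert_subset hv fun x hx => (hXl x hx).1
  have hvR : v ∉ R := by rw [hR]; simp
  have hRX : Disjoint R X :=
    Finset.disjoint_of_subset_right (Finset.subset_insert _ _) Finset.sdiff_disjoint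
  have hvA : G.nb v A = 9 := by rw [← nb_core_add_links (i := 2) (M := 2) (cap := cap), hm, hn]; rfl
  have hnbvX : G.nb v X = 9 := by rw [hX, nb_nbrs, hn]
  have hvR0 : G.nb v R = 0 := by
    have := nb_sdiff_add (G := G) (z := v) hsub
    rw [G.nb_insert v hvX, G.ind_self, hnbvX, hvA, ← hR] at this
    omega
  have hpos : ∀ T ⊆ R, 0 ≤ G.pot 2 2 cap T := fun T hT => by
    rcases T.eq_empty_or_nonempty with rfl | hne
    · simp
    have hc : (insert v X).card ≤ (A \ T).card := Finset.card_le_card fun x hx =>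
      Finset.mem_sdiff.2 ⟨hsub hx, fun hxT => (Finset.mem_sdiff.1 (hT hxT)).2 hx⟩
    rw [Finset.card_insert_of_notMem hvX] at hc
    have := h.pot_ge_two (hT.trans Finset.sdiff_subset) hne (by omega)
    simpa using this
  -- a set of small potential cannot contain the outer ends of all nine links
  have big : ∀ W ⊆ R, G.pot 2 2 cap W ≤ 1 → (∀ x ∈ X, G.nb x W = 1) → False := by
    intro W hW hpW hall
    have hWX : Disjoint W X := Finset.disjoint_of_subset_left hW hRX
    have hvWX : v ∉ W ∪ X := by
      rw [Finset.mem_union, not_or]; exact ⟨fun h' => hvR (hW h'), hvX⟩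
    have e1 : G.pot 2 2 cap X = 45 := by
      have c1 : G.edges X = 0 := by
        have := G.two_mul_edges X
        rw [Finset.sum_eq_zero fun x hx => le_antisymm
          ((G.nb_mono x hXX).trans (hXl x hx).2.2.1.le) (G.nb_nonneg x X)] at this
        omega
      unfold pot
      rw [c1, Finset.sum_congr rfl fun x hx => (hXl x hx).2.1.1, Finset.sum_const, hXc]
      norm_num
    have e2 : ∑ x ∈ X, G.nb x W = 9 := by
      rw [Finset.sum_congr rfl hall, Finset.sum_const, hXc]; norm_num
    have e3 : G.nb v W = 0 :=
      le_antisymm ((G.nb_mono v hW).trans hvR0.le) (G.nb_nonneg v W)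
    have a := h.sparse (insert v (W ∪ X)) (Finset.insert_subset hv
      (Finset.union_subset (hW.trans Finset.sdiff_subset) fun x hx => (hXl x hx).1))
      (Finset.insert_nonempty _ _)
    rw [G.pot_insert hvWX, G.pot_union hWX, e1, e2, G.nb_union v hWX, e3, hnbvX, hw] at a
    linarith
  have hup : ∀ x ∈ X, ∀ S T, S ⊆ T → T ⊆ R → G.nb x S = 1 → G.nb x T = 1 := by
    intro x hx S T hST hT h1
    have a := G.nb_mono x hST
    have b := G.nb_mono x hT
    rw [(hXl x hx).2.2.2.1] at b
    omega
  obtain ⟨x, hx, hx0⟩ : ∃ x ∈ X, ∀ T ⊆ R, G.nb x T = 1 → 1 ≤ G.pot 2 2 cap T := by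
    by_contra hcon
    push Not at hcon
    obtain ⟨T, ⟨hT, hpT⟩, hTX⟩ := exists_union (X := X) (T₀ := ∅)
      (P := fun x T => x ∈ X ∧ (T ⊆ R → G.nb x T = 1))
      (Q := fun T => T ⊆ R ∧ G.pot 2 2 cap T ≤ 0) ⟨by simp, by simp⟩
      (fun S T hS hT => ⟨Finset.union_subset hS.1 hT.1, by
        have a := G.pot_submodular (M := 2) (cap := cap) (by norm_num : (0 : ℤ) ≤ 2) S T
        have b := hpos (S ∩ T) (Finset.inter_subset_left.trans hS.1)
        linarith [hS.2, hT.2]⟩)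
      (fun x S T hST hS => ⟨hS.1, fun hTR => hup x hS.1 S T hST hTR (hS.2 (hST.trans hTR))⟩)
      (fun x hx => by
        obtain ⟨T, a, b, c⟩ := hcon x hx
        exact ⟨T, ⟨a, by omega⟩, hx, fun _ => b⟩)
    exact big T hT (by omega) fun x hx => (hTX x hx).2 hT
  obtain ⟨x', hx', hxx', hgood⟩ : ∃ x' ∈ X, x ≠ x' ∧
      ∀ T ⊆ R, G.nb x T = 1 → G.nb x' T = 1 → 2 ≤ G.pot 2 2 cap T := by
    by_contra hcon
    push Not at hcon
    obtain ⟨x₁, hx₁, hne₁⟩ := Finset.exists_mem_ne (by omega : 1 < X.card) x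
    obtain ⟨T₁, t1, t2, t3, t4⟩ := hcon x₁ hx₁ hne₁.symm
    obtain ⟨T, ⟨hT, hxT, hpT⟩, hTX⟩ := exists_union (X := X) (T₀ := T₁)
      (P := fun y T => y ∈ X ∧ (T ⊆ R → G.nb y T = 1))
      (Q := fun T => T ⊆ R ∧ G.nb x T = 1 ∧ G.pot 2 2 cap T ≤ 1) ⟨t1, t2, by omega⟩
      (fun S T hS hT => ⟨Finset.union_subset hS.1 hT.1,
        hup x hx S _ Finset.subset_union_left (Finset.union_subset hS.1 hT.1) hS.2.1, by
        have a := G.pot_submodular (M := 2) (cap := cap) (by norm_num : (0 : ℤ) ≤ 2) S T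
        have hin : G.nb x (S ∩ T) = 1 := by
          have u1 := G.nb_union_inter x S T
          have u2 := hup x hx S _ Finset.subset_union_left (Finset.union_subset hS.1 hT.1) hS.2.1
          rw [u2, hS.2.1, hT.2.1] at u1
          omega
        have b := hx0 (S ∩ T) (Finset.inter_subset_left.trans hS.1) hin
        linarith [hS.2.2, hT.2.2]⟩)
      (fun x S T hST hS => ⟨hS.1, fun hTR => hup x hS.1 S T hST hTR (hS.2 (hST.trans hTR))⟩)
      (fun y hy => by
        by_cases hyx : y = x
        · subst hyx
          exact ⟨T₁, ⟨t1, t2, by omega⟩, hy, fun _ => t2⟩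
        · obtain ⟨T, a, b, c, e⟩ := hcon y hy (Ne.symm hyx)
          exact ⟨T, ⟨a, b, by omega⟩, hy, fun _ => c⟩)
    exact big T hT (by omega) fun x hx => (hTX x hx).2 hT
  have hcap := h.cap_of_wt hv (by rw [hw]; norm_num)
  refine h.peel hv (S := {x, x'}) (R := R) (fun y hy => ?_) rfl ?_ fun T hT hne => ?_
  · rcases Finset.mem_insert.1 hy with rfl | hy
    · exact hx
    · rwa [Finset.mem_singleton.1 hy]
  · rw [hvR0, hn, Finset.card_pair hxx', hcap.1, hcap.2]; norm_num
  · have e0 : G.nb v T = 0 := le_antisymm ((G.nb_mono v hT).trans hvR0.le) (G.nb_nonneg v T)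
    rw [Finset.sum_pair hxx', e0]
    have b1 := G.nb_mono x hT
    have b2 := G.nb_mono x' hT
    rw [(hXl x hx).2.2.2.1] at b1
    rw [(hXl x' hx').2.2.2.1] at b2
    have b3 := hpos T hT
    have b4 := hgood T hT
    have b5 := G.nb_nonneg x T
    have b6 := G.nb_nonneg x' T
    by_cases c1 : G.nb x T = 1
    · by_cases c2 : G.nb x' T = 1
      · have := b4 c1 c2
        rw [c1, c2]; linarith
      · have : G.nb x' T = 0 := by omega
        rw [c1, this]; linarith
    · have : G.nb x T = 0 := by omega
      rw [this]; linarith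

/-- After the links have sent their deficit to the core, every vertex of the core has nonnegative
surplus. -/
lemma surplus_nonneg (h : G.Obstruction i M cap A) (hi : i = 1 ∨ i = 2) {v : V}
    (hv : v ∈ G.core i M cap A) :
    2 * wt M cap v ≤ (i + 1) * G.nb v (G.core i M cap A) + G.nb v (G.links i M cap A) := by
  classical
  obtain ⟨hvA, hl⟩ := mem_core.1 hv
  have hM := h.le
  have hbd := h.bounded v hvA
  have hD := nb_core_add_links (G := G) (i := i) (M := M) (cap := cap) (A := A) v
  have hm0 := G.nb_nonneg v (G.core i M cap A)
  have hn0 := G.nb_nonneg v (G.links i M cap A)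
  by_contra hlt
  push Not at hlt
  have hb : 0 ≤ cap v true := by
    by_contra hneg
    have : 0 ≤ (i + 1) * G.nb v (G.core i M cap A) := mul_nonneg (by omega) hm0
    unfold wt at hlt
    omega
  obtain ⟨d1, d2⟩ := h.nb_lower_bounds hvA hl hb
  have ha : 0 ≤ cap v false := by
    by_contra hneg
    have : 0 ≤ i * G.nb v (G.core i M cap A) := mul_nonneg (by omega) hm0
    have e : (i + 1) * G.nb v (G.core i M cap A)
      = i * G.nb v (G.core i M cap A) + G.nb v (G.core i M cap A) := by ring
    unfold wt at hlt
    omega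
  have d3 := d2 ha
  set X := G.nbrs v (G.links i M cap A) with hX
  set R := A \ insert v X with hR
  have hXl : ∀ x ∈ X, x ∈ A ∧ G.IsLink i M cap A x ∧ G.nb x (G.links i M cap A) = 0 ∧
    G.nb x R = 1 ∧ x ≠ v := fun x hx => h.link_nbr hvA hx
  have hvX : v ∉ X := fun hv' => (hXl v hv').2.2.2.2 rfl
  have hXc : (X.card : ℤ) = G.nb v (G.links i M cap A) := card_nbrs (G := G) v _
  have hsub : insert v X ⊆ A := Finset.insert_subset hvA fun x hx => (hXl x hx).1
  have hnbR : G.nb v R = G.nb v (G.core i M cap A) := by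
    have := nb_sdiff_add (G := G) (z := v) hsub
    rw [G.nb_insert v hvX, G.ind_self, hX, nb_nbrs, ← hX, ← hR, ← hD] at this
    omega
  have hRA : R ⊆ A := Finset.sdiff_subset
  have hcardR : ∀ T ⊆ R, 1 ≤ G.nb v (G.links i M cap A) → 2 ≤ (A \ T).card := fun T hT h1 => by
    have hc : (insert v X).card ≤ (A \ T).card := Finset.card_le_card fun x hx =>
      Finset.mem_sdiff.2 ⟨hsub hx, fun hxT => (Finset.mem_sdiff.1 (hT hxT)).2 hx⟩
    rw [Finset.card_insert_of_notMem hvX] at hc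
    omega
  have peel0 : G.nb v R ≤ 1 → 1 ≤ G.nb v (G.links i M cap A) →
      G.nb v R + G.nb v (G.links i M cap A) ≤ cap v false + cap v true + 1 → False :=
    fun h1 h2 h3 => h.peel hvA (S := ∅) (R := R) (by simp) rfl (by simpa using h3)
      fun T hT hne => by
        have a := h.pot_ge_two (hT.trans hRA) hne (hcardR T hT h2)
        have b := G.nb_mono v hT
        simp only [Finset.sum_empty, add_zero]
        linarith
  have hm : G.nb v (G.core i M cap A) < 2 := by
    by_contra h2
    have : i * 2 ≤ i * G.nb v (G.core i M cap A) :=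
      mul_le_mul_of_nonneg_left (by omega) (by omega)
    have e : (i + 1) * G.nb v (G.core i M cap A)
      = i * G.nb v (G.core i M cap A) + G.nb v (G.core i M cap A) := by ring
    unfold wt at hlt
    omega
  obtain hm | hm : G.nb v (G.core i M cap A) = 1 ∨ G.nb v (G.core i M cap A) = 0 := by omega
  · rw [hm] at hlt hD hnbR
    unfold wt at hlt
    exact peel0 (by omega) (by omega) (by omega)
  · rw [hm] at hlt hD hnbR
    by_cases h9 : G.nb v (G.links i M cap A) = cap v false + cap v true + 2
    · obtain ⟨x, hx⟩ : X.Nonempty := Finset.card_pos.1 (by omega)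
      refine h.peel hvA (S := {x}) (R := R) (Finset.singleton_subset_iff.2 hx) rfl
        (by rw [hnbR]; simp; omega) fun T hT hne => ?_
      have a := h.pot_ge_two (hT.trans hRA) hne (hcardR T hT (by omega))
      have b := G.nb_mono v hT
      have c := G.nb_mono x hT
      rw [(hXl x hx).2.2.2.1] at c
      rw [Finset.sum_singleton]
      omega
    · by_cases h10 : G.nb v (G.links i M cap A) ≤ cap v false + cap v true + 1
      · exact peel0 (by omega) (by omega) (by omega)
      · unfold wt at hlt
        obtain rfl : i = 2 := by omega
        obtain rfl : M = 2 := by omega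
        exact h.nine_links hvA (by unfold wt; omega) hm (by omega)

end Obstruction

end SignedGraph

/-! ### Sparse sets are colourable -/

namespace SignedGraph

variable {V : Type u} {G : SignedGraph V} {i M : ℤ} {cap : V → Bool → ℤ} {A : Finset V}
variable [DecidableEq V]

/-- Hall's theorem with capacities: the elements of `C` can be assigned to their ends such that
`v` receives at most `slack v` of them. -/
lemma exists_assignment {C : Finset V} {ends : V → Finset V} {slack : V → ℕ}
    (h : ∀ D ⊆ C, D.card ≤ ∑ v ∈ D.biUnion ends, slack v) :
    ∃ g : V → V, (∀ x ∈ C, g x ∈ ends x) ∧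
      ∀ v, (C.filter fun x => g x = v).card ≤ slack v := by
  classical
  obtain ⟨f, hinj, hf⟩ := (Finset.all_card_le_biUnion_card_iff_exists_injective
    (ι := {x // x ∈ C}) (fun x => (ends x).sigma fun v => Finset.range (slack v))).1 (fun s => by
      have a := h (s.map (Function.Embedding.subtype _)) (fun x hx => by
        obtain ⟨y, _, rfl⟩ := Finset.mem_map.1 hx
        exact y.2)
      rw [Finset.card_map] at a
      refine a.trans (le_of_eq ?_)
      have : s.biUnion (fun x => (ends x).sigma fun v => Finset.range (slack v))
          = ((s.map (Function.Embedding.subtype _)).biUnion ends).sigma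
            fun v => Finset.range (slack v) := by
        ext ⟨v, k⟩
        simp only [Finset.mem_biUnion, Finset.mem_sigma, Finset.mem_map]
        constructor
        · rintro ⟨x, hx, h1, h2⟩
          exact ⟨⟨x, ⟨x, hx, rfl⟩, h1⟩, h2⟩
        · rintro ⟨⟨_, ⟨x, hx, rfl⟩, h1⟩, h2⟩
          exact ⟨x, hx, h1, h2⟩
      rw [this, Finset.card_sigma]
      simp)
  refine ⟨fun x => if hx : x ∈ C then (f ⟨x, hx⟩).1 else x, fun x hx => ?_, fun v => ?_⟩
  · simp only [dif_pos hx]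
    exact (Finset.mem_sigma.1 (hf ⟨x, hx⟩)).1
  · rw [← Finset.card_range (slack v)]
    refine Finset.card_le_card_of_injOn
      (fun x => if hx : x ∈ C then (f ⟨x, hx⟩).2 else 0) (fun x hx => ?_) ?_
    · obtain ⟨h1, h2⟩ := Finset.mem_filter.1 (Finset.mem_coe.1 hx)
      simp only [dif_pos h1] at h2
      simp only [dif_pos h1]
      have := (Finset.mem_sigma.1 (hf ⟨x, h1⟩)).2
      rw [h2] at this
      exact Finset.mem_coe.2 this
    · intro x hx y hy hxy
      obtain ⟨h1, h2⟩ := Finset.mem_filter.1 (Finset.mem_coe.1 hx)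
      obtain ⟨h3, h4⟩ := Finset.mem_filter.1 (Finset.mem_coe.1 hy)
      simp only [dif_pos h1] at h2
      simp only [dif_pos h3] at h4
      simp only [dif_pos h1, dif_pos h3] at hxy
      have : f ⟨x, h1⟩ = f ⟨y, h3⟩ := Sigma.ext (h2.trans h4.symm) (heq_of_eq hxy)
      exact congrArg Subtype.val (hinj this)

lemma sum_con_insert (φ : V → Bool) {v : V} {T : Finset V} (h : v ∉ T) :
    ∑ x ∈ insert v T, G.con φ x (insert v T) = ∑ x ∈ T, G.con φ x T + 2 * G.con φ v T := by
  rw [Finset.sum_insert h, G.con_insert φ v h, G.conf_self]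
  have : ∑ x ∈ T, G.con φ x (insert v T) = ∑ x ∈ T, (G.conf φ v x + G.con φ x T) :=
    Finset.sum_congr rfl fun x _ => by rw [G.con_insert φ x h, G.conf_comm]
  rw [this, Finset.sum_add_distrib]
  unfold con; ring

/-- The indicator of the event that a link `x` with both neighbours in `U` has one conflict
whichever way it is coloured, that is, its two neighbours exclude different colours. -/
def splits (G : SignedGraph V) (U : Finset V) (φ : V → Bool) (x : V) : ℤ :=
  if G.clash φ true x U = 1 then 1 else 0

/-- The quantity minimized by the colouring of the core `U`: twice the number of conflicts inside
`U`, plus the number of split links, minus twice the sum of the capacities in use. -/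
def energy (G : SignedGraph V) (cap : V → Bool → ℤ) (U O : Finset V) (φ : V → Bool) : ℤ :=
  ∑ v ∈ U, G.con φ v U + ∑ x ∈ O, G.splits U φ x - 2 * ∑ v ∈ U, cap v (φ v)

/-- The excess of `v` is twice its conflicts in `U` plus its split links minus twice its capacity.
Changing the colour of `v` does not lower the least energy, so the excess of `v` is at most the
average of its values for the two colours. -/
lemma excess_le_of_energy_min {U O : Finset V} {φ : V → Bool}
    (hmin : ∀ ψ, G.energy cap U O φ ≤ G.energy cap U O ψ)
    (hO : ∀ x ∈ O, G.nb x U = 2) {v : V} (hv : v ∈ U) :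
    2 * (2 * G.con φ v U + ∑ x ∈ O, G.ind v x * G.splits U φ x - 2 * cap v (φ v))
      ≤ 2 * G.nb v U + G.nb v O - 2 * (cap v false + cap v true) := by
  set W := U.erase v with hW
  have hvW : v ∉ W := Finset.notMem_erase v U
  have hU : U = insert v W := (Finset.insert_erase hv).symm
  let ψ := Function.update φ v (!φ v)
  have ψv : ψ v = !φ v := Function.update_self ..
  have ψW : ∀ y ∈ W, ψ y = φ y := fun y hy =>
    Function.update_of_ne (Finset.ne_of_mem_erase hy) ..
  have c1 : G.con φ v W + G.con ψ v W = G.nb v W := by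
    rw [G.con_eq_clash rfl, G.con_eq_clash ψv, G.clash_congr ψW, ← G.clash_add_clash φ v W]
    cases φ v <;> simp [add_comm]
  have c2 : ∑ u ∈ W, G.con ψ u W = ∑ u ∈ W, G.con φ u W :=
    Finset.sum_congr rfl fun u hu => G.con_congr (ψW u hu) ψW
  have c3 : ∑ u ∈ W, cap u (ψ u) = ∑ u ∈ W, cap u (φ u) :=
    Finset.sum_congr rfl fun u hu => by rw [ψW u hu]
  have c4 : cap v (φ v) + cap v (ψ v) = cap v false + cap v true := by
    rw [ψv]; cases φ v <;> simp [add_comm]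
  -- flipping `v` toggles the state of every link at `v`
  have c5 : ∀ x ∈ O, G.splits U ψ x = G.splits U φ x + G.ind v x
      - 2 * (G.ind v x * G.splits U φ x) := by
    intro x hx
    have hW' : ∀ χ : V → Bool, G.clash χ true x U
        = (if G.sign x v = some (xor true (χ v)) then 1 else 0) + G.clash χ true x W := fun χ => by
      rw [hU]; exact Finset.sum_insert hvW
    have e1 := hW' φ
    have e2 := hW' ψ
    rw [G.clash_congr ψW, ψv] at e2
    have b1 := G.clash_le_nb φ true x U
    have b2 := G.clash_le_nb ψ true x U
    have b3 := G.clash_nonneg φ true x U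
    have b4 := G.clash_nonneg ψ true x U
    rw [hO x hx] at b1 b2
    unfold splits
    rcases hs : G.sign x v with _ | s
    · have : G.ind v x = 0 := by rw [G.ind_comm]; simp [ind, hs]
      rw [hs] at e1 e2
      simp only [reduceCtorEq, if_false, zero_add] at e1 e2
      rw [e1, e2, this]; ring
    · have : G.ind v x = 1 := by rw [G.ind_comm]; simp [ind, hs]
      rw [hs] at e1 e2
      rw [this]
      have e3 : (if some s = some (true ^^ φ v) then (1 : ℤ) else 0)
          + (if some s = some (true ^^ !φ v) then 1 else 0) = 1 := by
        cases s <;> cases φ v <;> simp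
      have e4 : (0 : ℤ) ≤ if some s = some (true ^^ φ v) then 1 else 0 := by split_ifs <;> simp
      have e5 : (0 : ℤ) ≤ if some s = some (true ^^ !φ v) then 1 else 0 := by split_ifs <;> simp
      generalize (if some s = some (true ^^ φ v) then (1 : ℤ) else 0) = p at *
      generalize (if some s = some (true ^^ !φ v) then (1 : ℤ) else 0) = q at *
      split_ifs <;> omega
  have c6 : ∑ x ∈ O, G.splits U ψ x = ∑ x ∈ O, G.splits U φ x + G.nb v O
      - 2 * ∑ x ∈ O, G.ind v x * G.splits U φ x := by
    rw [Finset.sum_congr rfl c5, Finset.sum_sub_distrib, Finset.sum_add_distrib, Finset.mul_sum]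
    rfl
  have hm := hmin ψ
  have hnb : G.nb v U = G.nb v W := by
    conv_lhs => rw [hU]
    rw [G.nb_insert v hvW, G.ind_self, zero_add]
  have hcon : ∀ χ, G.con χ v U = G.con χ v W := fun χ => by
    conv_lhs => rw [hU]
    rw [G.con_insert χ v hvW, G.conf_self, zero_add]
  have hE : ∀ χ, G.energy cap U O χ = ∑ u ∈ W, G.con χ u W + 2 * G.con χ v W
      + ∑ x ∈ O, G.splits U χ x - 2 * (cap v (χ v) + ∑ u ∈ W, cap u (χ u)) := fun χ => by
    unfold energy
    have s1 : ∑ u ∈ U, G.con χ u U = ∑ u ∈ W, G.con χ u W + 2 * G.con χ v W := by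
      conv_lhs => rw [hU]
      exact sum_con_insert χ hvW
    have s2 : ∑ u ∈ U, cap u (χ u) = cap v (χ v) + ∑ u ∈ W, cap u (χ u) := by
      conv_lhs => rw [hU]
      exact Finset.sum_insert hvW
    rw [s1, s2]
  rw [hE, hE, c2, c3, c6] at hm
  rw [hnb, hcon]
  linarith

namespace Obstruction

/-- Each link has weight `2 * i + 1` and lies on two edges, which costs one unit of potential; half
of it is charged to each neighbour. -/
lemma sum_surplus (h : G.Obstruction i M cap A) :
    ∑ v ∈ G.core i M cap A, ((i + 1) * G.nb v (G.core i M cap A) + G.nb v (G.links i M cap A)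
      - 2 * wt M cap v) = -(2 * G.pot i M cap A) := by
  set U := G.core i M cap A with hU
  set O := G.links i M cap A with hO
  have hd : Disjoint U O := disjoint_core_links
  have hA : A = U ∪ O := core_union_links.symm
  have hOO : ∀ x ∈ O, G.nb x O = 0 := fun x hx => Finset.sum_eq_zero fun y hy =>
    h.ind_link_link (mem_links.1 hx).1 (mem_links.1 hy).1 (mem_links.1 hx).2 (mem_links.1 hy).2
  have hOU : ∀ x ∈ O, G.nb x U = 2 := fun x hx => by
    have a := nb_core_add_links (G := G) (i := i) (M := M) (cap := cap) (A := A) x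
    rw [(mem_links.1 hx).2.2, ← hO, hOO x hx, ← hU] at a
    omega
  have e1 : ∑ v ∈ U, G.nb v O = 2 * O.card := by
    rw [sum_nb_comm, Finset.sum_congr rfl hOU]; simp [mul_comm]
  have e2 := G.edges_union hd
  have e3 : ∑ x ∈ O, G.nb x U = 2 * O.card := by
    rw [Finset.sum_congr rfl hOU]; simp [mul_comm]
  have e4 := G.two_mul_edges U
  have e5 : G.edges O = 0 := by
    have := G.two_mul_edges O
    rw [Finset.sum_congr rfl hOO] at this
    simpa using this
  have e6 : ∑ x ∈ O, wt M cap x = (2 * i + 1) * O.card := by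
    have : ∀ x ∈ O, wt M cap x = 2 * i + 1 := fun x hx => (mem_links.1 hx).2.1
    rw [Finset.sum_congr rfl this]; simp [mul_comm]
  have e7 : G.pot i M cap A = ∑ v ∈ U, wt M cap v + ∑ x ∈ O, wt M cap x
      - (i + 1) * G.edges (U ∪ O) := by
    rw [← Finset.sum_union hd, ← hA]; rfl
  rw [Finset.sum_sub_distrib, Finset.sum_add_distrib, ← Finset.mul_sum, ← Finset.mul_sum, ← e4,
    e1, e7, e2, e3, e5, e6]
  ring

end Obstruction

/-- In a colouring of the core of least energy, every nonempty set of core vertices has total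
excess at most one. This is Hall's condition for the assignment of each split link to an end that
has room for the conflict. -/
lemma not_obstruction [Finite V] (hi : i = 1 ∨ i = 2) : ¬ G.Obstruction i M cap A := by
  intro h
  have hM := h.le
  have h1 := h.one_le
  have hne : A.Nonempty := by
    by_contra he
    rw [Finset.not_nonempty_iff_eq_empty] at he
    exact h.not_colorable ⟨fun _ => true, by simp [he]⟩
  set U := G.core i M cap A with hU
  set O := G.links i M cap A with hO
  have hd : Disjoint U O := disjoint_core_links
  have hOO : ∀ x ∈ O, G.nb x O = 0 := fun x hx => Finset.sum_eq_zero fun y hy =>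
    h.ind_link_link (mem_links.1 hx).1 (mem_links.1 hy).1 (mem_links.1 hx).2 (mem_links.1 hy).2
  have hOU : ∀ x ∈ O, G.nb x U = 2 := fun x hx => by
    have a := nb_core_add_links (G := G) (i := i) (M := M) (cap := cap) (A := A) x
    rw [(mem_links.1 hx).2.2, ← hO, hOO x hx, ← hU] at a
    omega
  obtain ⟨φ, hφ⟩ := Finite.exists_min (G.energy cap U O)
  let po : V → ℤ := fun v => ∑ x ∈ O, G.ind v x * G.splits U φ x
  have hsp : ∀ x, 0 ≤ G.splits U φ x := fun x => by unfold splits; split_ifs <;> simp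
  have hpo : ∀ v, 0 ≤ po v := fun v =>
    Finset.sum_nonneg fun x _ => mul_nonneg (G.ind_nonneg v x) (hsp x)
  have excess : ∀ T ⊆ U, T.Nonempty →
      ∑ v ∈ T, (2 * G.con φ v U + po v - 2 * cap v (φ v)) ≤ 1 := by
    intro T hT hTne
    have a : ∀ v ∈ T, 2 * (2 * G.con φ v U + po v - 2 * cap v (φ v)) ≤
        ((i + 1) * G.nb v U + G.nb v O - 2 * wt M cap v) + (2 - 2 * M) := fun v hv => by
      have b := excess_le_of_energy_min hφ hOU (hT hv)
      have c : 0 ≤ (i - 1) * G.nb v U := mul_nonneg (by omega) (G.nb_nonneg v U)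
      simp only [po]
      unfold wt
      linarith
    have b := Finset.sum_le_sum a
    rw [← Finset.mul_sum, Finset.sum_add_distrib, Finset.sum_const, nsmul_eq_mul] at b
    have c : ∑ v ∈ T, ((i + 1) * G.nb v U + G.nb v O - 2 * wt M cap v)
        ≤ ∑ v ∈ U, ((i + 1) * G.nb v U + G.nb v O - 2 * wt M cap v) :=
      Finset.sum_le_sum_of_subset_of_nonneg hT fun v hv _ => by
        have := h.surplus_nonneg hi hv
        linarith
    have d := h.sum_surplus
    have e := h.sparse A subset_rfl hne
    have f : (1 : ℤ) ≤ T.card := by exact_mod_cast hTne.card_pos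
    have g : (T.card : ℤ) * (2 - 2 * M) ≤ 1 * (2 - 2 * M) :=
      mul_le_mul_of_nonpos_right f (by omega)
    linarith
  have hslack : ∀ v ∈ U, G.con φ v U ≤ cap v (φ v) := fun v hv => by
    have a := excess {v} (Finset.singleton_subset_iff.2 hv) (Finset.singleton_nonempty v)
    rw [Finset.sum_singleton] at a
    have := hpo v
    omega
  obtain ⟨g, hg1, hg2⟩ := exists_assignment (C := O.filter fun x => G.clash φ true x U = 1)
    (ends := fun x => G.nbrs x U) (slack := fun v => (cap v (φ v) - G.con φ v U).toNat)
    (fun D hD => by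
      rcases D.eq_empty_or_nonempty with rfl | hDne
      · simp
      set T := D.biUnion fun x => G.nbrs x U with hT
      have hDO : D ⊆ O := hD.trans (Finset.filter_subset _ _)
      have hTU : T ⊆ U := by
        intro v hv
        obtain ⟨x, _, hx⟩ := Finset.mem_biUnion.1 hv
        exact (mem_nbrs.1 hx).1
      have hnbT : ∀ x ∈ D, G.nb x T = 2 := fun x hx => by
        have a := G.nb_mono x (Finset.subset_biUnion_of_mem (fun x => G.nbrs x U) hx)
        have b := G.nb_mono x hTU
        rw [nb_nbrs, hOU x (hDO hx)] at a
        rw [hOU x (hDO hx)] at b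
        exact le_antisymm b a
      have hTne : T.Nonempty := by
        obtain ⟨x, hx⟩ := hDne
        by_contra he
        rw [Finset.not_nonempty_iff_eq_empty] at he
        have := hnbT x hx
        rw [he] at this; simp at this
      have a := excess T hTU hTne
      have b : 2 * (D.card : ℤ) ≤ ∑ v ∈ T, po v := by
        calc 2 * (D.card : ℤ) = ∑ x ∈ D, G.nb x T := by
              rw [Finset.sum_congr rfl hnbT]; simp [mul_comm]
          _ = ∑ v ∈ T, G.nb v D := sum_nb_comm _ _
          _ ≤ ∑ v ∈ T, po v := by
              refine Finset.sum_le_sum fun v _ => ?_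
              calc G.nb v D = ∑ x ∈ D, G.ind v x * G.splits U φ x :=
                    Finset.sum_congr rfl fun x hx => by
                      unfold splits
                      rw [if_pos (Finset.mem_filter.1 (hD hx)).2, mul_one]
                _ ≤ po v := Finset.sum_le_sum_of_subset_of_nonneg hDO fun x _ _ =>
                    mul_nonneg (G.ind_nonneg v x) (hsp x)
      have c : ((∑ v ∈ T, (cap v (φ v) - G.con φ v U).toNat : ℕ) : ℤ)
          = ∑ v ∈ T, (cap v (φ v) - G.con φ v U) := by
        rw [Nat.cast_sum]
        exact Finset.sum_congr rfl fun v hv => Int.toNat_of_nonneg (by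
          have := hslack v (hTU hv)
          omega)
      refine Int.ofNat_le.1 ?_
      rw [c]
      rw [Finset.sum_sub_distrib]
      rw [Finset.sum_sub_distrib, Finset.sum_add_distrib, ← Finset.mul_sum, ← Finset.mul_sum] at a
      omega)
  -- the colours of the links
  have hχ : ∀ x, ∃ b, x ∈ O → G.clash φ b x U ≤ 1 ∧
      ∀ v ∈ U, G.sign x v = some (xor b (φ v)) → G.clash φ true x U = 1 ∧ g x = v := by
    intro x
    by_cases hx : x ∈ O
    swap
    · exact ⟨true, fun h' => absurd h' hx⟩
    have e1 := G.clash_add_clash φ x U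
    rw [hOU x hx] at e1
    have e2 := G.clash_nonneg φ false x U
    have e3 := G.clash_nonneg φ true x U
    by_cases hc : G.clash φ true x U = 1
    · have hgx := mem_nbrs.1 (hg1 x (Finset.mem_filter.2 ⟨hx, hc⟩))
      obtain ⟨s, hs⟩ := Option.isSome_iff_exists.1 (ind_eq_one_iff.1 hgx.2)
      refine ⟨xor s (φ (g x)), fun _ => ?_⟩
      have hcl : G.clash φ (xor s (φ (g x))) x U = 1 := by
        cases xor s (φ (g x))
        · omega
        · exact hc
      refine ⟨hcl.le, fun v hv hsv => ⟨hc, ?_⟩⟩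
      by_contra hne
      have : ∑ y ∈ ({g x, v} : Finset V),
          (if G.sign x y = some (xor (xor s (φ (g x))) (φ y)) then (1 : ℤ) else 0)
          ≤ G.clash φ (xor s (φ (g x))) x U :=
        Finset.sum_le_sum_of_subset_of_nonneg (by
          intro y hy
          rcases Finset.mem_insert.1 hy with rfl | hy
          · exact hgx.1
          · rwa [Finset.mem_singleton.1 hy]) fun y _ _ => by split_ifs <;> simp
      rw [Finset.sum_pair hne, if_pos hsv, if_pos (by rw [hs]; simp), hcl] at this
      linarith
    · obtain ⟨b, hb⟩ : ∃ b, G.clash φ b x U = 0 := by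
        by_cases h0 : G.clash φ true x U = 0
        · exact ⟨true, h0⟩
        · exact ⟨false, by omega⟩
      refine ⟨b, fun _ => ⟨by omega, fun v hv hsv => ?_⟩⟩
      have := (Finset.sum_eq_zero_iff_of_nonneg
        (fun y _ => by split_ifs <;> simp)).1 hb v hv
      rw [if_pos hsv] at this
      simp at this
  choose χ hχ using hχ
  obtain ⟨ψ, h2, h3⟩ := exists_glue U φ χ
  have h3' : ∀ x ∈ O, ψ x = χ x := fun x hx => h3 x (Finset.disjoint_right.1 hd hx)
  refine h.not_colorable ⟨ψ, fun v hv => ?_⟩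
  have hA : U ∪ O = A := core_union_links
  rw [← hA] at hv ⊢
  rw [G.con_union ψ v hd]
  rcases Finset.mem_union.1 hv with hvU | hvO
  · rw [G.con_congr (h2 v hvU) h2, h2 v hvU]
    have a : G.con ψ v O ≤
        ((O.filter fun x => G.clash φ true x U = 1).filter fun x => g x = v).card := by
      rw [Finset.filter_filter, Finset.card_filter]; push_cast
      refine Finset.sum_le_sum fun x hx => ?_
      unfold conf
      rw [h2 v hvU, h3' x hx]
      split_ifs with p q
      · rfl
      · exact absurd ((hχ x hx).2 v hvU (by rw [G.symm, p, Bool.xor_comm])) q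
      · simp
      · rfl
    have b := hg2 v
    have c := hslack v hvU
    zify at b
    rw [Int.toNat_of_nonneg (by omega)] at b
    linarith
  · rw [con_eq_zero_of_nb (hOO v hvO), G.con_eq_clash (h3' v hvO), G.clash_congr h2]
    have a := (hχ v hvO).1
    have b := h.one_le_cap (mem_links.1 hvO).1 (mem_links.1 hvO).2.1 (ψ v)
    linarith

/-- Every sparse set can be coloured. -/
theorem sparseColorable [Finite V] (hi : i = 1 ∨ i = 2) (hM : i ≤ M) (N : ℕ) :
    G.SparseColorable i M N := by
  induction N with
  | zero => intro A cap hA; omega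
  | succ N ih =>
    intro A cap hA hb hs
    by_contra hc
    exact not_obstruction (G := G) hi (A := A) (cap := cap)
      ⟨by omega, hM, hb, hs, ih.mono (by omega), hc⟩

end SignedGraph

/-! ### Covers and the lower bound -/

namespace DPCover

variable {V : Type u} {G : SimpleGraph V}

lemma inducedDegree_eq (C : DPCover G) {φ : V → C.Node} (hφ : Function.Injective φ) (v : V) :
    C.inducedDegree φ ⟨φ v, v, rfl⟩ = {u | C.H.Adj (φ v) (φ u)}.encard := by
  unfold inducedDegree inducedGraph
  have hinj : Function.Injective fun u => (⟨φ u, u, rfl⟩ : Set.range φ) := fun a b hab =>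
    hφ (congrArg Subtype.val hab)
  rw [← hinj.encard_image]
  congr 1
  ext ⟨_, u, rfl⟩
  simp only [SimpleGraph.mem_neighborSet, SimpleGraph.comap_adj, Set.mem_image,
    Set.mem_ofPred_eq]
  constructor
  · intro h; exact ⟨u, h, rfl⟩
  · rintro ⟨w, h, hw⟩
    rw [← hφ (congrArg Subtype.val hw)]; exact h

end DPCover

/-- The capacities of an `(i, j)`-defective colouring. -/
def defectCap (i j : ℕ) {V : Type u} (_ : V) (b : Bool) : ℤ := if b then j else i

namespace SignedGraph

variable {V : Type u}

/-- A signed graph is supported on `G` if its edges are edges of `G`. -/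
def SupportedOn (S : SignedGraph V) (G : SimpleGraph V) : Prop :=
  ∀ x y, (S.sign x y).isSome → G.Adj x y

/-- The underlying simple graph of a signed graph. -/
def graph (S : SignedGraph V) : SimpleGraph V where
  Adj x y := (S.sign x y).isSome
  symm := ⟨fun x y h => by rw [S.symm]; exact h⟩
  loopless := ⟨fun x h => by rw [S.loopless] at h; simp at h⟩

lemma edges_univ [Fintype V] [DecidableEq V] (S : SignedGraph V) :
    S.edges Finset.univ = S.graph.edgeSet.ncard := by
  classical
  have a := S.two_mul_edges Finset.univ
  have b := S.graph.sum_degrees_eq_twice_card_edges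
  have c : ∀ v, S.nb v Finset.univ = (S.graph.degree v : ℤ) := fun v => by
    rw [← SimpleGraph.card_neighborFinset_eq_degree, SimpleGraph.neighborFinset_eq_filter,
      Finset.card_filter]
    push_cast
    refine Finset.sum_congr rfl fun u _ => ?_
    by_cases hs : (S.sign v u).isSome
    · rw [if_pos (show S.graph.Adj v u from hs), ind, if_pos hs]
    · rw [if_neg (show ¬ S.graph.Adj v u from hs), ind, if_neg hs]
  have d : (S.graph.edgeSet.ncard : ℤ) = S.graph.edgeFinset.card := by
    rw [← SimpleGraph.coe_edgeFinset, Set.ncard_coe_finset]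
  have f : ∑ v, (S.graph.degree v : ℤ) = 2 * S.graph.edgeFinset.card := by exact_mod_cast b
  rw [Finset.sum_congr rfl fun v _ => c v, f] at a
  omega

/-- The pullback of a signed graph along a map of vertices. -/
def comap {W : Type*} (f : W → V) (S : SignedGraph V) : SignedGraph W where
  sign x y := S.sign (f x) (f y)
  symm _ _ := S.symm _ _
  loopless _ := S.loopless _

lemma con_eq_card [Fintype V] (S : SignedGraph V) (φ : V → Bool) (v : V) :
    {u | S.sign v u = some (xor (φ v) (φ u))}.encard = ((S.con φ v Finset.univ).toNat : ℕ∞) := by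
  classical
  have h1 : {u | S.sign v u = some (xor (φ v) (φ u))}
      = ((Finset.univ.filter fun u => S.sign v u = some (xor (φ v) (φ u)) : Finset V) : Set V) := by
    ext; simp
  have h2 : S.con φ v Finset.univ
      = (Finset.univ.filter fun u => S.sign v u = some (xor (φ v) (φ u))).card := by
    rw [Finset.card_filter]; push_cast; rfl
  rw [h1, Set.encard_coe_eq_coe_finsetCard, h2, Int.toNat_natCast]

lemma Colorable.of_comap {W : Type*} [Fintype W] {f : W → V} (hf : Function.Injective f)
    {S : SignedGraph V} {cap : V → Bool → ℤ} {T : Finset V} (hT : (T : Set V) = Set.range f)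
    (h : (S.comap f).Colorable (fun w => cap (f w)) Finset.univ) : S.Colorable cap T := by
  classical
  obtain ⟨φ, hφ⟩ := h
  have hT' : T = Finset.univ.map ⟨f, hf⟩ := by
    apply Finset.coe_injective
    rw [hT]; simp
  refine ⟨Function.extend f φ fun _ => true, fun v hv => ?_⟩
  rw [← Finset.mem_coe, hT] at hv
  obtain ⟨w, rfl⟩ := hv
  have a := hφ w (Finset.mem_univ w)
  rw [hf.extend_apply]
  refine le_trans (le_of_eq ?_) a
  rw [hT']
  unfold con conf
  rw [Finset.sum_map]
  simp only [Function.Embedding.coeFn_mk, hf.extend_apply]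
  rfl

end SignedGraph

open SignedGraph in
/-- A signed graph defines a 2-fold cover on `V × Bool`, so its colouring follows from that of
the cover. -/
lemma IsDPColorable.colorable {V : Type u} [Fintype V] {G : SimpleGraph V} {i j : ℕ}
    (h : IsDPColorable G i j) {S : SignedGraph V} (hS : S.SupportedOn G) :
    S.Colorable (defectCap i j) Finset.univ := by
  let C : DPCover G :=
    { Node := V × Bool
      H :=
        { Adj := fun x y => (x.1 = y.1 ∧ x.2 ≠ y.2) ∨ S.sign x.1 y.1 = some (xor x.2 y.2)
          symm := ⟨fun x y hxy => by
            rcases hxy with ⟨h1, h2⟩ | h1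
            · exact Or.inl ⟨h1.symm, h2.symm⟩
            · right; rw [S.symm, h1, Bool.xor_comm]⟩
          loopless := ⟨fun x hx => by
            rcases hx with ⟨_, h2⟩ | h1
            · exact h2 rfl
            · rw [S.loopless] at h1; simp at h1⟩ }
      L := fun v => {(v, false), (v, true)}
      partition := by
        rintro ⟨v, b⟩
        refine ⟨v, by cases b <;> simp, fun w hw => ?_⟩
        simp only [Set.mem_insert_iff, Set.mem_singleton_iff, Prod.mk.injEq] at hw
        rcases hw with hw | hw <;> exact hw.1.symm
      complete := by
        rintro v ⟨x, a⟩ ⟨y, b⟩ hx hy hne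
        simp only [Set.mem_insert_iff, Set.mem_singleton_iff, Prod.mk.injEq] at hx hy
        have h1 : x = v := by rcases hx with hx | hx <;> exact hx.1
        have h2 : y = v := by rcases hy with hy | hy <;> exact hy.1
        subst h1 h2
        exact Or.inl ⟨rfl, fun hab => hne (by simpa using hab)⟩
      edges_over := by
        rintro v w ⟨x, a⟩ ⟨y, b⟩ hx hy hadj
        simp only [Set.mem_insert_iff, Set.mem_singleton_iff, Prod.mk.injEq] at hx hy
        have h1 : x = v := by rcases hx with hx | hx <;> exact hx.1
        have h2 : y = w := by rcases hy with hy | hy <;> exact hy.1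
        subst h1 h2
        rcases hadj with h3 | h3
        · exact Or.inl h3.1
        · exact Or.inr (hS _ _ (by simp only at h3; simp [h3]))
      matching := by
        rintro v w ⟨x, a⟩ ⟨y, b⟩ ⟨z, c⟩ hvw hx hy hz h1 h2
        simp only [Set.mem_insert_iff, Set.mem_singleton_iff, Prod.mk.injEq] at hx hy hz
        have e1 : x = v := by rcases hx with hx | hx <;> exact hx.1
        have e2 : y = w := by rcases hy with hy | hy <;> exact hy.1
        have e3 : z = w := by rcases hz with hz | hz <;> exact hz.1
        subst e1 e2 e3
        rcases h1 with h1 | h1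
        · exact absurd h1.1 hvw.ne
        rcases h2 with h2 | h2
        · exact absurd h2.1 hvw.ne
        simp only at h1 h2
        rw [h1] at h2
        revert h2
        cases a <;> cases b <;> cases c <;> simp }
  obtain ⟨φ, ⟨hinj, hL⟩, hp, hr⟩ := h C (fun v => (v, false)) (fun v => (v, true))
    (fun v => Set.encard_pair fun hv => Bool.false_ne_true (congrArg Prod.snd hv)) (fun v => rfl)
  have h1 : ∀ v, φ v = (v, (φ v).2) := fun v => by
    rcases hL v with h | h <;> rw [h]
  refine ⟨fun v => (φ v).2, fun v _ => ?_⟩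
  have hdeg : C.inducedDegree φ ⟨φ v, v, rfl⟩
      = ((S.con (fun v => (φ v).2) v Finset.univ).toNat : ℕ∞) := by
    rw [C.inducedDegree_eq hinj, ← S.con_eq_card]
    congr 1
    ext u
    change ((φ v).1 = (φ u).1 ∧ (φ v).2 ≠ (φ u).2 ∨
      S.sign (φ v).1 (φ u).1 = some (xor (φ v).2 (φ u).2)) ↔ _
    have e1 : (φ v).1 = v := congrArg Prod.fst (h1 v)
    have e2 : (φ u).1 = u := congrArg Prod.fst (h1 u)
    rw [e1, e2]
    constructor
    · rintro (⟨rfl, h⟩ | h)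
      · exact absurd rfl h
      · exact h
    · exact Or.inr
  change _ ≤ if (φ v).2 = true then (j : ℤ) else i
  rcases hb : (φ v).2 with _ | _
  · have := hp ⟨φ v, v, rfl⟩
      ⟨v, show ((v, false) : V × Bool) = φ v from Prod.ext (congrArg Prod.fst (h1 v)).symm hb.symm⟩
    rw [hdeg] at this
    have : (S.con (fun v => (φ v).2) v Finset.univ).toNat ≤ i := by exact_mod_cast this
    rw [if_neg Bool.false_ne_true]
    omega
  · have := hr ⟨φ v, v, rfl⟩
      ⟨v, show ((v, true) : V × Bool) = φ v from Prod.ext (congrArg Prod.fst (h1 v)).symm hb.symm⟩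
    rw [hdeg] at this
    have : (S.con (fun v => (φ v).2) v Finset.univ).toNat ≤ j := by exact_mod_cast this
    rw [if_pos rfl]
    omega

open SignedGraph in
open Classical in
/-- The matchings of a 2-fold cover can be completed to perfect matchings, and a perfect matching
is one of the two signs of an edge. Hence it suffices to colour signed graphs. -/
lemma isDPColorable_of_colorable {V : Type u} [Fintype V] {G : SimpleGraph V} {i j : ℕ}
    (h : ∀ S : SignedGraph V, S.SupportedOn G → S.Colorable (defectCap i j) Finset.univ) :
    IsDPColorable G i j := by
  intro C p r h2 hpr
  have hne : ∀ v, p v ≠ r v := fun v hv => by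
    have := h2 v
    rw [hpr v, hv, Set.pair_eq_singleton, Set.encard_singleton] at this
    norm_num at this
  have hpL : ∀ v, p v ∈ C.L v := fun v => by rw [hpr v]; simp
  have hrL : ∀ v, r v ∈ C.L v := fun v => by rw [hpr v]; simp
  let N : V → Bool → C.Node := fun v b => if b then r v else p v
  have hN : ∀ v b, N v b ∈ C.L v := fun v b => by
    cases b
    · exact hpL v
    · exact hrL v
  have hNinj : ∀ v a b, N v a = N v b → a = b := fun v a b => by
    have := hne v
    cases a <;> cases b <;> simp [N, this, this.symm]
  let same : V → V → Prop := fun x y => C.H.Adj (p x) (p y) ∨ C.H.Adj (r x) (r y)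
  let diff : V → V → Prop := fun x y => C.H.Adj (p x) (r y) ∨ C.H.Adj (r x) (p y)
  have hsame : ∀ x y, same x y ↔ same y x := fun x y => by
    simp only [same, C.H.adj_comm (p x), C.H.adj_comm (r x)]
  have hdiff : ∀ x y, diff x y ↔ diff y x := fun x y => by
    simp only [diff, C.H.adj_comm (p x), C.H.adj_comm (r x)]
    exact or_comm
  let S : SignedGraph V :=
    { sign := fun x y => if x = y then none else if same x y then some false
        else if diff x y then some true else none
      symm := fun x y => by
        simp only [hsame x y, hdiff x y, eq_comm (a := x) (b := y)]
      loopless := fun x => by simp }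
  have adjOf : ∀ x y a b, x ≠ y → C.H.Adj (N x a) (N y b) → G.Adj x y := fun x y a b hxy hadj =>
    (C.edges_over x y _ _ (hN x a) (hN y b) hadj).resolve_left hxy
  have hsupp : S.SupportedOn G := by
    intro x y hxy
    simp only [S] at hxy
    split_ifs at hxy with h1 h2 h3
    · simp at hxy
    · rcases h2 with h2 | h2
      · exact adjOf x y false false h1 h2
      · exact adjOf x y true true h1 h2
    · rcases h3 with h3 | h3
      · exact adjOf x y false true h1 h3
      · exact adjOf x y true false h1 h3
    · simp at hxy
  have uniq : ∀ x y a b c, x ≠ y → C.H.Adj (N x a) (N y b) → C.H.Adj (N x a) (N y c) → b = c :=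
    fun x y a b c hxy h1 h2 => hNinj y b c
      (C.matching x y _ _ _ (adjOf x y a b hxy h1) (hN x a) (hN y b) (hN y c) h1 h2)
  have uniq' : ∀ x y a b c, x ≠ y → C.H.Adj (N x b) (N y a) → C.H.Adj (N x c) (N y a) → b = c :=
    fun x y a b c hxy h1 h2 => uniq y x a b c hxy.symm h1.symm h2.symm
  have hsign : ∀ x y a b, x ≠ y → C.H.Adj (N x a) (N y b) → S.sign x y = some (xor a b) := by
    intro x y a b hxy hadj
    simp only [S, if_neg hxy]
    by_cases hab : a = b
    · subst hab
      rw [if_pos, Bool.xor_self]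
      cases a
      · exact Or.inl hadj
      · exact Or.inr hadj
    · have hx : xor a b = true := by revert hab; cases a <;> cases b <;> simp
      rw [hx, if_neg, if_pos]
      · revert hab hadj
        cases a <;> cases b
        · simp
        · exact fun hadj _ => Or.inl hadj
        · exact fun hadj _ => Or.inr hadj
        · simp
      · rintro (h' | h')
        · cases a
          · exact hab (uniq x y false false b hxy h' hadj)
          · cases b
            · exact absurd (uniq' x y false true false hxy hadj h') (by simp)
            · exact hab rfl
        · cases a
          · cases b
            · exact hab rfl
            · exact absurd (uniq' x y true false true hxy hadj h') (by simp)
          · exact hab (uniq x y true true b hxy h' hadj)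
  obtain ⟨ψ, hψ⟩ := h S hsupp
  have hφinj : Function.Injective fun v => N v (ψ v) := fun u v huv => by
    obtain ⟨w, _, hw⟩ := C.partition (N v (ψ v))
    rw [hw v (hN v _)]
    refine hw u ?_
    have := hN u (ψ u)
    dsimp only at huv
    rwa [huv] at this
  have hdeg : ∀ v, C.inducedDegree (fun v => N v (ψ v)) ⟨N v (ψ v), v, rfl⟩
      ≤ ((S.con ψ v Finset.univ).toNat : ℕ∞) := fun v => by
    rw [C.inducedDegree_eq hφinj, ← S.con_eq_card]
    refine Set.encard_le_encard fun u hu => ?_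
    refine hsign v u _ _ ?_ hu
    rintro rfl
    exact C.H.loopless.irrefl _ hu
  have key : ∀ (b : Bool) (x : Set.range fun v => N v (ψ v)),
      (x : C.Node) ∈ Set.range (fun v => N v b) →
      C.inducedDegree (fun v => N v (ψ v)) x ≤ ((if b then j else i : ℕ) : ℕ∞) := by
    rintro b ⟨_, v, rfl⟩ ⟨u, hu⟩
    have huv : u = v := by
      obtain ⟨w, _, hw⟩ := C.partition (N v (ψ v))
      rw [hw v (hN v _)]
      refine hw u ?_
      have := hN u b
      dsimp only at hu
      rwa [hu] at this
    subst huv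
    have hb : b = ψ u := hNinj _ _ _ hu
    refine (hdeg u).trans ?_
    have a := hψ u (Finset.mem_univ u)
    unfold defectCap at a
    rw [← hb] at a
    have : (S.con ψ u Finset.univ).toNat ≤ (if b then j else i : ℕ) := by
      cases b <;> simp at a ⊢ <;> omega
    exact_mod_cast this
  exact ⟨fun v => N v (ψ v), ⟨hφinj, fun v => hN v _⟩,
    fun x hx => key false x hx, fun x hx => key true x hx⟩

namespace SignedGraph

variable {V : Type u} [DecidableEq V]

lemma bounded_defectCap {i j : ℕ} (A : Finset V) :
    Bounded i ((j : ℤ) - i) (defectCap i j) A := fun v _ => by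
  simp [defectCap]

lemma wt_defectCap (i j : ℕ) (v : V) :
    wt ((j : ℤ) - i) (defectCap i j) v = 2 * i + 1 := by
  simp [wt, defectCap]; ring

lemma pot_defectCap (S : SignedGraph V) (i j : ℕ) (T : Finset V) :
    S.pot i ((j : ℤ) - i) (defectCap i j) T = (2 * i + 1) * T.card - (i + 1) * S.edges T := by
  unfold pot
  rw [Finset.sum_congr rfl fun v _ => wt_defectCap i j v, Finset.sum_const, nsmul_eq_mul, mul_comm]

end SignedGraph

open SignedGraph in
/-- The edge bound in integers. Otherwise the whole vertex set has potential at least `-M` in some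
uncolourable signed graph on `G`. A nonempty set of least potential is colourable, by criticality
if it is proper and by sparsity if it is everything, and its colouring extends. -/
lemma IsDPCritical.edge_bound {V : Type u} [Finite V] {G : SimpleGraph V} {i j : ℕ}
    (hi : i = 1 ∨ i = 2) (hj : 2 * i ≤ j) (h : IsDPCritical G i j) :
    (2 * i + 1) * (Nat.card V : ℤ) + (j - i) + 1 ≤ (i + 1) * (G.edgeSet.ncard : ℤ) := by
  classical
  have := Fintype.ofFinite V
  obtain ⟨hnc, hsub⟩ := h
  obtain ⟨S, hS, hSc⟩ : ∃ S : SignedGraph V, S.SupportedOn G ∧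
      ¬ S.Colorable (defectCap i j) Finset.univ := by
    by_contra hcon
    push Not at hcon
    exact hnc (isDPColorable_of_colorable hcon)
  have hedges : S.edges Finset.univ ≤ G.edgeSet.ncard := by
    rw [edges_univ]
    exact_mod_cast Set.ncard_le_ncard (SimpleGraph.edgeSet_mono (fun x y hxy => hS x y hxy))
  suffices hpot : S.pot i ((j : ℤ) - i) (defectCap i j) Finset.univ ≤ -((j : ℤ) - i) - 1 by
    rw [pot_defectCap, Finset.card_univ, ← Nat.card_eq_fintype_card] at hpot
    have := mul_le_mul_of_nonneg_left hedges (by positivity : (0 : ℤ) ≤ i + 1)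
    linarith
  by_contra hpot
  have hi' : (i : ℤ) = 1 ∨ (i : ℤ) = 2 := by omega
  have hcol : ∀ N, S.SparseColorable i ((j : ℤ) - i) N := sparseColorable hi' (by omega)
  have hbd := bounded_defectCap (V := V) (i := i) (j := j) Finset.univ
  have hne : (Finset.univ : Finset V).Nonempty := by
    by_contra he
    rw [Finset.not_nonempty_iff_eq_empty] at he
    exact hSc ⟨fun _ => true, by simp [he]⟩
  -- a nonempty set of least potential
  obtain ⟨T, hT, hmin⟩ := Finset.exists_min_image
    (Finset.univ.filter fun T : Finset V => T.Nonempty)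
    (S.pot i ((j : ℤ) - i) (defectCap i j)) ⟨Finset.univ, by simpa using hne⟩
  have hTne : T.Nonempty := (Finset.mem_filter.1 hT).2
  have hmin' : ∀ T' : Finset V, T'.Nonempty → S.pot i ((j : ℤ) - i) (defectCap i j) T ≤
      S.pot i ((j : ℤ) - i) (defectCap i j) T' := fun T' hT' => hmin T' (by simpa using hT')
  by_cases hTu : T = Finset.univ
  · subst hTu
    exact hSc (hcol _ Finset.univ _ (Nat.lt_succ_self _) hbd fun T' _ hT' => by
      have := hmin' T' hT'
      omega)
  · let H : G.Subgraph := (⊤ : G.Subgraph).induce (T : Set V)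
    have hH : H ≠ ⊤ := fun hH => hTu (by
      have : H.verts = Set.univ := by rw [hH]; rfl
      exact Finset.coe_eq_univ.1 this)
    have hHc : IsDPColorable H.coe i j := hsub H hH
    have hfin : Fintype H.verts := Fintype.ofFinite _
    have hTc : S.Colorable (defectCap i j) T := by
      refine Colorable.of_comap (f := ((↑) : H.verts → V)) Subtype.val_injective ?_
        (hHc.colorable (S := S.comap ((↑) : H.verts → V)) fun x y hxy => ?_)
      · rw [Subtype.range_coe_subtype]; rfl
      · simp only [H, SimpleGraph.Subgraph.coe_adj, SimpleGraph.Subgraph.induce_adj,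
          SimpleGraph.Subgraph.top_adj]
        exact ⟨x.2, y.2, hS _ _ hxy⟩
    exact hSc ((hcol _).colorable_of_extension (by omega) (by omega) (Finset.subset_univ T) hTc hbd
      (Nat.lt_succ_self _) fun Y _ => hmin' _ (hTne.mono Finset.subset_union_left))

/-! ### Subgraphs of extremal graphs -/

namespace SignedGraph

/-- A certificate that every proper subgraph of a signed graph is colourable. The ends of each edge
share its cost `i + 1`, where `p x y` is the part paid by `x` for the edge `xy`; a vertex pays
`2 * i + 1` in total, except that the root pays `i + j + 2`; and positive payments lead from the
root to every vertex. -/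
structure Payment {V : Type u} [Fintype V] (S : SignedGraph V) (i j : ℕ) (root : V)
    (p : V → V → ℤ) : Prop where
  nonneg : ∀ x y, 0 ≤ p x y
  eq_zero : ∀ x y, S.sign x y = none → p x y = 0
  add_eq : ∀ x y, (S.sign x y).isSome → p x y + p y x = i + 1
  load : ∀ x, x ≠ root → ∑ y, p x y = 2 * i + 1
  load_root : ∑ y, p root y = i + j + 2
  spread : ∀ T : Set V, root ∈ T → (∀ x ∈ T, ∀ y, 1 ≤ p x y → y ∈ T) → T = Set.univ

namespace Payment

variable {V : Type u} [Fintype V] {S : SignedGraph V} {i j : ℕ} {root : V} {p : V → V → ℤ}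

lemma comap {W : Type*} [Fintype W] (e : W ≃ V) (h : S.Payment i j root p) :
    (S.comap e).Payment i j (e.symm root) fun x y => p (e x) (e y) where
  nonneg x y := h.nonneg _ _
  eq_zero x y := h.eq_zero _ _
  add_eq x y := h.add_eq _ _
  load x hx := by
    rw [e.sum_comp fun y => p (e x) y]
    exact h.load _ fun hx' => hx (by rw [← hx', e.symm_apply_apply])
  load_root := by
    rw [e.apply_symm_apply, e.sum_comp fun y => p root y]; exact h.load_root
  spread T hT hs := by
    have := h.spread (e.symm ⁻¹' T) hT fun x hx y hy => hs _ hx _ (by simpa using hy)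
    rw [← Set.preimage_univ (f := e), ← this]
    ext; simp

lemma sum_load [DecidableEq V] (h : S.Payment i j root p) (T : Finset V) :
    ∑ x ∈ T, ∑ y, p x y = (2 * i + 1) * T.card + if root ∈ T then (j : ℤ) - i + 1 else 0 := by
  have : ∀ x, ∑ y, p x y = (2 * i + 1) + if x = root then (j : ℤ) - i + 1 else 0 := fun x => by
    split_ifs with hx
    · rw [hx, h.load_root]; ring
    · rw [h.load x hx]; ring
  rw [Finset.sum_congr rfl fun x _ => this x, Finset.sum_add_distrib, Finset.sum_ite_eq',
    Finset.sum_const, nsmul_eq_mul, mul_comm]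

lemma card_edges (h : S.Payment i j root p) :
    ((i : ℤ) + 1) * S.graph.edgeSet.ncard = (2 * i + 1) * Fintype.card V + (j - i) + 1 := by
  classical
  rw [← edges_univ]
  have a := S.two_mul_edges Finset.univ
  have b : ((i : ℤ) + 1) * ∑ x, S.nb x Finset.univ = 2 * ∑ x, ∑ y, p x y := by
    have c : ∀ x y, ((i : ℤ) + 1) * S.ind x y = p x y + p y x := fun x y => by
      unfold ind
      split_ifs with hs
      · rw [h.add_eq x y hs, mul_one]
      · rw [Option.not_isSome_iff_eq_none] at hs
        rw [h.eq_zero x y hs, h.eq_zero y x (by rw [S.symm, hs])]; ring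
    unfold nb
    simp_rw [Finset.mul_sum, c, Finset.sum_add_distrib]
    rw [Finset.sum_comm (f := fun x y => p y x)]
    simp_rw [← Finset.mul_sum]
    ring
  have d := h.sum_load Finset.univ
  rw [if_pos (Finset.mem_univ _), Finset.card_univ] at d
  rw [← a, d] at b
  linarith

lemma edges_eq {W : Type*} [Fintype W] [DecidableEq W] [DecidableEq V]
    (h : S.Payment i j root p) (f : W ↪ V)
    {S' : SignedGraph W} (hS' : ∀ x y, (S'.sign x y).isSome → (S.sign (f x) (f y)).isSome)
    (T : Finset W) :
    ((i : ℤ) + 1) * S'.edges T = ∑ x ∈ T, ∑ y ∈ T, S'.ind x y * p (f x) (f y) := by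
  have a := S'.two_mul_edges T
  have b : ((i : ℤ) + 1) * ∑ x ∈ T, S'.nb x T
      = ∑ x ∈ T, ∑ y ∈ T, S'.ind x y * p (f x) (f y)
        + ∑ x ∈ T, ∑ y ∈ T, S'.ind y x * p (f y) (f x) := by
    unfold nb
    rw [Finset.mul_sum, ← Finset.sum_add_distrib]
    refine Finset.sum_congr rfl fun x _ => ?_
    rw [Finset.mul_sum, ← Finset.sum_add_distrib]
    refine Finset.sum_congr rfl fun y _ => ?_
    rw [S'.ind_comm y x, ← mul_add]
    rcases S'.ind_cases x y with h0 | h1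
    · rw [h0]; ring
    · rw [h1, h.add_eq _ _ (hS' x y (ind_eq_one_iff.1 h1))]; ring
  rw [Finset.sum_comm (f := fun x y => S'.ind y x * p (f y) (f x)), ← a] at b
  linarith

/-- A set without the root has nonnegative potential. A set with the root has potential at least
`-M - 1`, and equality would force all positive payments to stay inside, so that the set and the
subgraph are everything. -/
lemma isDPColorable_of_ne_top (h : S.Payment i j root p) (hi : i = 1 ∨ i = 2) (hj : 2 * i ≤ j)
    {H : S.graph.Subgraph} (hH : H ≠ ⊤) : IsDPColorable H.coe i j := by
  classical
  have hfin : Fintype H.verts := Fintype.ofFinite _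
  refine isDPColorable_of_colorable fun S' hS' => ?_
  refine sparseColorable (i := i) (M := (j : ℤ) - i) (by omega) (by omega) _ Finset.univ _
    (Nat.lt_succ_self _) (bounded_defectCap _) fun T _ hTne => ?_
  rw [pot_defectCap]
  let f : H.verts ↪ V := Function.Embedding.subtype _
  have hadj : ∀ x y : H.verts, (S'.sign x y).isSome → H.Adj x y := fun x y hxy => hS' x y hxy
  have e1 := h.edges_eq f (S' := S') (fun x y hxy => H.adj_sub (hadj x y hxy)) T
  have e2 := h.sum_load (T.map f)
  rw [Finset.card_map, Finset.sum_map] at e2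
  have hle : ∀ x y, S'.ind x y * p (f x) (f y) ≤ p (f x) (f y) := fun x y => by
    have := mul_le_mul_of_nonneg_right (S'.ind_le_one x y) (h.nonneg (f x) (f y))
    linarith
  have hnn : ∀ x y, 0 ≤ S'.ind x y * p (f x) (f y) := fun x y =>
    mul_nonneg (S'.ind_nonneg x y) (h.nonneg _ _)
  have hrow : ∀ x ∈ T, ∑ y ∈ T, S'.ind x y * p (f x) (f y) ≤ ∑ y, p (f x) y := fun x _ => by
    calc ∑ y ∈ T, S'.ind x y * p (f x) (f y) ≤ ∑ y ∈ T, p (f x) (f y) :=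
          Finset.sum_le_sum fun y _ => hle x y
      _ = ∑ y ∈ T.map f, p (f x) y := (Finset.sum_map T f fun y => p (f x) y).symm
      _ ≤ ∑ y, p (f x) y := Finset.sum_le_sum_of_subset_of_nonneg (Finset.subset_univ _)
          fun y _ _ => h.nonneg _ _
  have hall := Finset.sum_le_sum hrow
  by_cases hroot : root ∈ T.map f
  · rw [if_pos hroot] at e2
    suffices hstrict : ∃ x ∈ T, ∑ y ∈ T, S'.ind x y * p (f x) (f y) < ∑ y, p (f x) y by
      have := Finset.sum_lt_sum hrow hstrict
      linarith
    by_contra hcon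
    push Not at hcon
    -- otherwise every payment made from `T` goes to an edge of `H` inside `T`
    have hinner : ∀ x ∈ T, ∀ v, 1 ≤ p (f x) v → ∃ y ∈ T, f y = v ∧ S'.ind x y = 1 := by
      intro x hx v hv
      by_contra hno
      push Not at hno
      refine absurd (hcon x hx) (not_le.2 ?_)
      calc ∑ y ∈ T, S'.ind x y * p (f x) (f y)
          = ∑ y ∈ T.filter fun y => f y ≠ v, S'.ind x y * p (f x) (f y) := by
            rw [Finset.sum_filter]
            refine Finset.sum_congr rfl fun y hy => ?_
            split_ifs with hne
            · rfl
            · have := (S'.ind_cases x y).resolve_right (hno y hy (not_not.1 hne))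
              rw [this, zero_mul]
        _ ≤ ∑ y ∈ T.filter fun y => f y ≠ v, p (f x) (f y) :=
            Finset.sum_le_sum fun y _ => hle x y
        _ = ∑ y ∈ (T.filter fun y => f y ≠ v).map f, p (f x) y :=
            (Finset.sum_map _ f fun y => p (f x) y).symm
        _ ≤ ∑ y ∈ Finset.univ.erase v, p (f x) y :=
            Finset.sum_le_sum_of_subset_of_nonneg (fun y hy => by
              obtain ⟨z, hz, rfl⟩ := Finset.mem_map.1 hy
              exact Finset.mem_erase.2 ⟨(Finset.mem_filter.1 hz).2, Finset.mem_univ _⟩)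
              fun y _ _ => h.nonneg _ _
        _ < ∑ y, p (f x) y := by
            rw [← Finset.add_sum_erase _ _ (Finset.mem_univ v)]; linarith
    have huniv := h.spread (T.map f : Finset V) (Finset.mem_coe.2 hroot) fun x hx v hv => by
      obtain ⟨z, hz, rfl⟩ := Finset.mem_map.1 (Finset.mem_coe.1 hx)
      obtain ⟨y, hy, rfl, _⟩ := hinner z hz v hv
      exact Finset.mem_coe.2 (Finset.mem_map_of_mem f hy)
    have hmem : ∀ v, ∃ x ∈ T, f x = v := fun v => by
      have : v ∈ ((T.map f : Finset V) : Set V) := by rw [huniv]; trivial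
      exact Finset.mem_map.1 (Finset.mem_coe.1 this)
    apply hH
    have hv : H.verts = Set.univ := Set.eq_univ_of_forall fun v => by
      obtain ⟨x, _, rfl⟩ := hmem v
      exact x.2
    have hpay : ∀ a b, 1 ≤ p a b → H.Adj a b := fun a b hab => by
      obtain ⟨x, hx, rfl⟩ := hmem a
      obtain ⟨y, hy, rfl, hxy⟩ := hinner x hx b hab
      exact hadj x y (ind_eq_one_iff.1 hxy)
    refine SimpleGraph.Subgraph.ext hv ?_
    ext a b
    simp only [SimpleGraph.Subgraph.top_adj]
    refine ⟨fun hab => H.adj_sub hab, fun hab => ?_⟩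
    have hsum := h.add_eq a b hab
    by_cases h1 : 1 ≤ p a b
    · exact hpay a b h1
    · exact (hpay b a (by omega)).symm
  · rw [if_neg hroot] at e2
    have : (0 : ℤ) ≤ (j : ℤ) - i := by omega
    linarith

lemma isDPCritical (h : S.Payment i j root p) (hi : i = 1 ∨ i = 2) (hj : 2 * i ≤ j)
    (hS : ¬ S.Colorable (defectCap i j) Finset.univ) : IsDPCritical S.graph i j :=
  ⟨fun hc => hS (hc.colorable fun _ _ hxy => hxy),
    fun _ hH => h.isDPColorable_of_ne_top hi hj hH⟩

end Payment

end SignedGraph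

/-! ### The extremal graphs and the theorem -/

namespace Caterpillar

/-- The vertices of a caterpillar with spine `s₀, …, sₜ`. Each `sₖ` with `k < t` has a family of
`i + 1` children, namely `i` leaves and `sₖ₊₁`. The vertex `s₀` is `none`, and `some (k, r)` is the
`r`-th child of `sₖ`, which is `sₖ₊₁` for `r = 0` and a leaf otherwise. -/
abbrev Vert (i t : ℕ) : Type := Option (Fin t × Fin (i + 1))

variable {i j t : ℕ}

/-- The number `k` for the spine vertex `sₖ`, and `t` for a leaf, so that exactly the vertices with
`idx v < t` have children. -/
def idx : Vert i t → ℕ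
  | none => 0
  | some (k, r) => if r = 0 then k + 1 else t

@[simp] lemma idx_none : idx (none : Vert i t) = 0 := rfl

lemma idx_some (k : Fin t) (r : Fin (i + 1)) :
    idx (some (k, r)) = if r = 0 then (k : ℕ) + 1 else t := rfl

/-- `w` is a child of `v`. -/
def Child (v : Vert i t) : Vert i t → Prop
  | none => False
  | some (k, _) => idx v = k

instance (v w : Vert i t) : Decidable (Child v w) := by
  unfold Child; split <;> infer_instance

lemma not_child_none (v : Vert i t) : ¬ Child v none := id

lemma child_some {v : Vert i t} {k : Fin t} {r : Fin (i + 1)} :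
    Child v (some (k, r)) ↔ idx v = k := Iff.rfl

/-- The common parent `sₖ` of the `k`-th family of children. -/
def parent (k : Fin t) : Vert i t :=
  if h : (k : ℕ) = 0 then none else some (⟨k - 1, by omega⟩, 0)

lemma idx_parent (k : Fin t) : idx (parent k : Vert i t) = k := by
  unfold parent
  split_ifs with h
  · simp [idx, h]
  · simp [idx]; omega

lemma eq_parent_iff (v : Vert i t) (k : Fin t) : idx v = k ↔ v = parent k := by
  constructor
  · intro h
    unfold parent
    rcases v with _ | ⟨l, r⟩
    · simp only [idx] at h
      rw [dif_pos h.symm]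
    · simp only [idx] at h
      split_ifs at h with hr
      · rw [dif_neg (by omega)]
        simp only [Option.some.injEq, Prod.mk.injEq, hr, and_true]
        ext; simp; omega
      · have := k.2; omega
  · rintro rfl; exact idx_parent k

lemma Child.idx_lt {v w : Vert i t} (h : Child v w) : idx v < idx w := by
  rcases w with _ | ⟨k, r⟩
  · exact h.elim
  · rw [child_some] at h
    rw [idx_some]
    have := k.2
    split_ifs <;> omega

/-- The vertices adjacent to the root: `s₀`, `sₜ` and the leaves. -/
def Top (v : Vert i t) : Prop := v = none ∨ t ≤ idx v

instance (v : Vert i t) : Decidable (Top v) := by unfold Top; infer_instance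

/-- The signs inside a caterpillar: a poor parent is in conflict with a poor child if the child is
a leaf or `sₜ`, and with a rich child otherwise. -/
def innerSign (v w : Vert i t) : Option Bool :=
  if Child v w then some (decide (idx w < t)) else
    if Child w v then some (decide (idx v < t)) else none

lemma innerSign_comm (v w : Vert i t) : innerSign v w = innerSign w v := by
  unfold innerSign
  by_cases h1 : Child v w
  · have h2 : ¬ Child w v := fun h2 => by have := h1.idx_lt; have := h2.idx_lt; omega
    rw [if_pos h1, if_neg h2, if_pos h1]
  · rw [if_neg h1]
    by_cases h2 : Child w v
    · rw [if_pos h2, if_pos h2]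
    · rw [if_neg h2, if_neg h2, if_neg h1]

lemma not_child_self (v : Vert i t) : ¬ Child v v := fun h => by have := h.idx_lt; omega

/-- Along an edge of a caterpillar the parent pays `1` and the child pays `i`. -/
def innerPay (v w : Vert i t) : ℤ := (if Child v w then 1 else 0) + if Child w v then (i : ℤ) else 0

lemma sum_child (v : Vert i t) : ∑ w, (if Child v w then (1 : ℤ) else 0)
    = if idx v < t then (i : ℤ) + 1 else 0 := by
  have h1 : ∀ (k : Fin t) (r : Fin (i + 1)),
      (if Child v (some (k, r)) then (1 : ℤ) else 0) = if idx v = k then 1 else 0 :=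
    fun k r => if_congr child_some rfl rfl
  rw [Fintype.sum_option, if_neg (not_child_none v), zero_add, Fintype.sum_prod_type]
  simp_rw [h1]
  simp only [Finset.sum_const, Finset.card_univ, Fintype.card_fin, nsmul_eq_mul]
  by_cases h : idx v < t
  · rw [if_pos h, Finset.sum_eq_single_of_mem (⟨idx v, h⟩ : Fin t) (Finset.mem_univ _)]
    · simp
    · intro k _ hk
      rw [if_neg, mul_zero]
      exact fun hk' => hk (Fin.ext hk'.symm)
  · rw [if_neg h]
    refine Finset.sum_eq_zero fun k _ => ?_
    rw [if_neg, mul_zero]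
    have := k.2; omega

lemma sum_parent (w : Vert i t) : ∑ v, (if Child v w then (i : ℤ) else 0)
    = if w = none then 0 else (i : ℤ) := by
  rcases w with _ | ⟨k, r⟩
  · simp [not_child_none]
  · simp only [child_some, eq_parent_iff]
    rw [Finset.sum_ite_eq']
    simp

/-- The vertices of the extremal graph: the root `none`, `j + 1` caterpillars of rich type (left)
and `i + 1` caterpillars of poor type (right). -/
abbrev Verts (i j t : ℕ) : Type := Option ((Fin (j + 1) ⊕ Fin (i + 1)) × Vert i t)

/-- The signs at the root: when the root has the colour that is the type of the caterpillar `a`,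
it is in conflict with the rich node of each vertex of `a` adjacent to it. -/
def rootSign (a : Fin (j + 1) ⊕ Fin (i + 1)) (v : Vert i t) : Option Bool :=
  if Top v then some (!a.isLeft) else none

/-- The extremal signed graph. -/
def extremal (i j t : ℕ) : SignedGraph (Verts i j t) where
  sign
    | none, none => none
    | none, some (a, v) => rootSign a v
    | some (a, v), none => rootSign a v
    | some (a, v), some (b, w) => if a = b then innerSign v w else none
  symm := by
    rintro (_ | ⟨a, v⟩) (_ | ⟨b, w⟩)
    · rfl
    · rfl
    · rfl
    · simp only [eq_comm (a := a) (b := b), innerSign_comm v w]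
  loopless := by
    rintro (_ | ⟨a, v⟩)
    · rfl
    · simp [innerSign, not_child_self]

/-- The payments in the extremal graph: `s₀` pays `i` to its edge to the root, which pays the
remaining `1`, while a leaf or `sₜ` pays all of its edge to the root. -/
def pay (i j t : ℕ) : Verts i j t → Verts i j t → ℤ
  | none, none => 0
  | none, some (_, v) => if v = none then 1 else 0
  | some (_, v), none => if v = none then i else if t ≤ idx v then i + 1 else 0
  | some (a, v), some (b, w) => if a = b then innerPay v w else 0

lemma payment (ht : 1 ≤ t) : (extremal i j t).Payment i j none (pay i j t) where
  nonneg := by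
    rintro (_ | ⟨a, v⟩) (_ | ⟨b, w⟩)
    · exact le_rfl
    all_goals
      simp only [pay, innerPay]
      split_ifs <;> positivity
  eq_zero := by
    rintro (_ | ⟨a, v⟩) (_ | ⟨b, w⟩) h
    · rfl
    · simp only [extremal, rootSign, Top] at h
      simp only [pay]
      split_ifs at h ⊢ <;> simp_all
    · simp only [extremal, rootSign, Top] at h
      simp only [pay]
      split_ifs at h ⊢ <;> simp_all
    · simp only [extremal, innerSign] at h
      simp only [pay, innerPay]
      split_ifs at h ⊢ <;> simp_all
  add_eq := by
    rintro (_ | ⟨a, v⟩) (_ | ⟨b, w⟩) h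
    · simp [extremal] at h
    · simp only [extremal, rootSign, Top] at h
      simp only [pay]
      split_ifs at h ⊢ <;> simp_all <;> omega
    · simp only [extremal, rootSign, Top] at h
      simp only [pay]
      split_ifs at h ⊢ <;> simp_all
    · simp only [extremal, innerSign] at h
      simp only [pay, innerPay]
      by_cases hab : a = b
      · subst hab
        simp only [if_true] at h ⊢
        by_cases h1 : Child v w
        · have h2 : ¬ Child w v := fun h2 => by have := h1.idx_lt; have := h2.idx_lt; omega
          simp only [h1, h2, if_true, if_false]; ring
        · have h2 : Child w v := by
            by_contra h2
            simp [h1, h2] at h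
          simp only [h1, h2, if_true, if_false]; ring
      · simp [hab] at h
  load := by
    rintro (_ | ⟨a, v⟩) hx
    · exact absurd rfl hx
    · rw [Fintype.sum_option, Fintype.sum_prod_type]
      simp only [pay]
      rw [Finset.sum_eq_single_of_mem a (Finset.mem_univ a)
        (fun b _ hb => Finset.sum_eq_zero fun w _ => if_neg hb.symm)]
      simp only [if_true, innerPay, Finset.sum_add_distrib, sum_child, sum_parent]
      by_cases hv : v = none
      · subst hv
        have h0 : idx (none : Vert i t) < t := by rw [idx_none]; omega
        simp only [if_true, if_pos h0]
        ring
      · rw [if_neg hv, if_neg hv]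
        split_ifs <;> omega
  load_root := by
    rw [Fintype.sum_option, Fintype.sum_prod_type]
    simp only [pay, Finset.sum_ite_eq', Finset.mem_univ, if_true, Finset.sum_const,
      Finset.card_univ, Fintype.card_sum, Fintype.card_fin, nsmul_eq_mul]
    push_cast; ring
  spread := by
    intro T hT hs
    have hroot : ∀ a, some (a, none) ∈ T := fun a => hs none hT _ (by simp [pay])
    have hstep : ∀ a v w, some (a, v) ∈ T → Child v w → some (a, w) ∈ T := fun a v w hv hc =>
      hs _ hv _ (by
        simp only [pay, innerPay, if_true, if_pos hc]
        split_ifs <;> omega)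
    have hall : ∀ a (n : ℕ) (k : Fin t) (r : Fin (i + 1)), (k : ℕ) = n →
        some (a, some (k, r)) ∈ T := by
      intro a n
      induction n with
      | zero =>
        intro k r hk
        exact hstep a none _ (hroot a) (show idx (none : Vert i t) = k by simp [idx, hk])
      | succ n ih =>
        intro k r hk
        exact hstep a (some (⟨n, by omega⟩, 0)) _ (ih _ _ rfl)
          (show idx (some (⟨n, by omega⟩, 0) : Vert i t) = k by simp [idx, hk])
    refine Set.eq_univ_of_forall ?_
    rintro (_ | ⟨a, _ | ⟨k, r⟩⟩)
    · exact hT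
    · exact hroot a
    · exact hall a k k r rfl

/-- In a caterpillar whose type is the colour of the root, some vertex is in conflict with the
root. Otherwise all vertices adjacent to the root are poor. A poor spine vertex is then in conflict
with its `i` leaves, which exhausts its capacity and makes the next spine vertex poor; but the last
one, being poor, is in conflict with its parent. -/
lemma exists_conflict (ht : 1 ≤ t) {φ : Verts i j t → Bool}
    (hφ : ∀ v, (extremal i j t).con φ v Finset.univ ≤ defectCap i j v (φ v))
    {a : Fin (j + 1) ⊕ Fin (i + 1)} (ha : φ none = a.isLeft) :
    ∃ v, (extremal i j t).sign none (some (a, v)) = some (xor (φ none) (φ (some (a, v)))) := by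
  by_contra hno
  push Not at hno
  have htop : ∀ v, Top v → φ (some (a, v)) = false := fun v hv => by
    have := hno v
    simp only [extremal, rootSign, if_pos hv, ha] at this
    by_contra hne
    rw [Bool.not_eq_false] at hne
    rw [hne] at this
    simp at this
  -- a poor spine vertex has no room for conflicts with all its children
  have hchild : ∀ k : Fin t, φ (some (a, parent k)) = false →
      φ (some (a, some (k, 0))) ≠ decide ((k : ℕ) + 1 < t) := by
    intro k hk hcon
    have hcap := hφ (some (a, parent k))
    rw [hk] at hcap
    have hc : ∀ r : Fin (i + 1), (extremal i j t).conf φ (some (a, parent k)) (some (a, some (k, r)))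
        = 1 := fun r => by
      have hch : Child (parent k : Vert i t) (some (k, r)) := idx_parent k
      unfold SignedGraph.conf
      refine if_pos ?_
      simp only [extremal, innerSign, if_true, if_pos hch, hk]
      by_cases hr : r = 0
      · subst hr; simp [hcon, idx_some]
      · rw [htop _ (Or.inr (by simp [idx_some, hr]))]
        simp [idx_some, hr]
    have hsum : ∑ r : Fin (i + 1),
        (extremal i j t).conf φ (some (a, parent k)) (some (a, some (k, r)))
        ≤ (extremal i j t).con φ (some (a, parent k)) Finset.univ := by
      let f : Fin (i + 1) ↪ Verts i j t :=
        ⟨fun r => some (a, some (k, r)), fun r r' h => by simpa using h⟩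
      have := Finset.sum_map Finset.univ f fun y =>
        (extremal i j t).conf φ (some (a, parent k)) y
      rw [← show _ = ∑ r : Fin (i + 1), (extremal i j t).conf φ (some (a, parent k))
        (some (a, some (k, r))) from this]
      exact Finset.sum_le_sum_of_subset_of_nonneg (Finset.subset_univ _)
        fun y _ _ => SignedGraph.conf_nonneg _ _ _ _
    rw [Finset.sum_congr rfl fun r _ => hc r] at hsum
    simp [defectCap] at hsum hcap
    omega
  have hspine : ∀ (n : ℕ) (k : Fin t), (k : ℕ) = n → φ (some (a, parent k)) = false := by
    intro n
    induction n with
    | zero =>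
      intro k hk
      refine htop _ (Or.inl ?_)
      unfold parent; rw [dif_pos hk]
    | succ n ih =>
      intro k hk
      have := hchild ⟨n, by omega⟩ (ih _ rfl)
      have hp : (parent k : Vert i t) = some (⟨n, by omega⟩, 0) := by
        unfold parent
        rw [dif_neg (by omega)]
        simp [hk]
      rw [hp]
      simp only at this
      rw [decide_eq_true (by omega)] at this
      simpa using this
  have hlast := hchild ⟨t - 1, by omega⟩ (hspine _ _ rfl)
  rw [htop _ (Or.inr (by simp [idx]; omega))] at hlast
  apply hlast
  simp; omega

/-- If the root has the colour `c`, then each caterpillar of type `c` holds a conflict with the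
root, and there are more of these than the capacity of the root. -/
lemma not_colorable (ht : 1 ≤ t) :
    ¬ (extremal i j t).Colorable (defectCap i j) Finset.univ := by
  rintro ⟨φ, hφ⟩
  have hφ' : ∀ v, (extremal i j t).con φ v Finset.univ ≤ defectCap i j v (φ v) :=
    fun v => hφ v (Finset.mem_univ v)
  have hroot := hφ' none
  have hrow : ∀ a : Fin (j + 1) ⊕ Fin (i + 1), (if φ none = a.isLeft then (1 : ℤ) else 0) ≤
      ∑ v, (extremal i j t).conf φ none (some (a, v)) := fun a => by
    split_ifs with ha
    · obtain ⟨v, hv⟩ := exists_conflict ht hφ' ha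
      have h1 : (extremal i j t).conf φ none (some (a, v)) = 1 := if_pos hv
      rw [← h1]
      exact Finset.single_le_sum (f := fun v => (extremal i j t).conf φ none (some (a, v)))
        (fun v _ => SignedGraph.conf_nonneg _ _ _ _) (Finset.mem_univ v)
    · exact Finset.sum_nonneg fun v _ => SignedGraph.conf_nonneg _ _ _ _
  have hsum := Finset.sum_le_sum fun a (_ : a ∈ Finset.univ) => hrow a
  unfold SignedGraph.con at hroot
  rw [Fintype.sum_option, Fintype.sum_prod_type, SignedGraph.conf_self] at hroot
  rw [Fintype.sum_sum_type] at hsum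
  simp only [Sum.isLeft_inl, Sum.isLeft_inr] at hsum
  unfold defectCap at hroot
  cases hc : φ none <;> simp [hc] at hsum hroot <;> linarith

lemma card_verts : Fintype.card (Verts i j t) = (i + j + 2) * (t * (i + 1) + 1) + 1 := by
  simp [Verts, Vert]; ring

end Caterpillar

lemma exists_isDPCritical {i j : ℕ} (hi : i = 1 ∨ i = 2) (hj : 2 * i ≤ j) {t : ℕ} (ht : 1 ≤ t) :
    ∃ G : SimpleGraph (Fin ((i + j + 2) * (t * (i + 1) + 1) + 1)), IsDPCritical G i j ∧
      (G.edgeSet.ncard : ℝ) = dpBound i j ((i + j + 2) * (t * (i + 1) + 1) + 1) := by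
  let e : Fin ((i + j + 2) * (t * (i + 1) + 1) + 1) ≃ Caterpillar.Verts i j t :=
    (Fintype.equivFinOfCardEq Caterpillar.card_verts).symm
  have hp := (Caterpillar.payment (i := i) (j := j) ht).comap e
  refine ⟨_, hp.isDPCritical hi hj fun hc => Caterpillar.not_colorable (i := i) (j := j) ht
    (SignedGraph.Colorable.of_comap e.injective (by simp) hc), ?_⟩
  have hcard := hp.card_edges
  rw [Fintype.card_fin] at hcard
  have hcard' : ((i : ℝ) + 1) * ((((Caterpillar.extremal i j t).comap e).graph.edgeSet.ncard : ℕ) : ℝ)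
      = (2 * i + 1) * (((i + j + 2) * (t * (i + 1) + 1) + 1 : ℕ) : ℝ) + (j - i) + 1 := by
    exact_mod_cast hcard
  unfold dpBound
  rw [eq_div_iff (by positivity)]
  push_cast at hcard' ⊢
  linarith

lemma IsDPCritical.dpBound_le {V : Type u} [Finite V] {G : SimpleGraph V} {i j : ℕ}
    (hi : i = 1 ∨ i = 2) (hj : 2 * i ≤ j) (h : IsDPCritical G i j) :
    dpBound i j (Nat.card V) ≤ (G.edgeSet.ncard : ℝ) := by
  have a := h.edge_bound hi hj
  have b : (2 * (i : ℝ) + 1) * (Nat.card V : ℝ) + (j - i) + 1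
      ≤ (i + 1) * (G.edgeSet.ncard : ℝ) := by exact_mod_cast a
  unfold dpBound
  rw [div_le_iff₀ (by positivity)]
  linarith

lemma ofReal_dpBound_le_gDP {i j : ℕ} (hi : i = 1 ∨ i = 2) (hj : 2 * i ≤ j) (n : ℕ) :
    ENNReal.ofReal (dpBound i j n) ≤ (gDP i j n : ENNReal) := by
  unfold gDP
  simp only [ENat.toENNReal_iInf]
  refine le_iInf₂ fun G hG => ?_
  have h := hG.dpBound_le hi hj
  rw [Nat.card_fin] at h
  rw [← Set.Finite.cast_ncard_eq (Set.toFinite G.edgeSet), ENat.toENNReal_coe]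
  exact ENNReal.ofReal_le_of_le_toReal (by simpa using h)

theorem theorem2p1 (i j : ℕ) (hi : i = 1 ∨ i = 2) (hj : 2 * i ≤ j) :
    (∀ (V : Type u) [Finite V] (G : SimpleGraph V), IsDPCritical G i j →
      dpBound i j (Nat.card V) ≤ (G.edgeSet.ncard : ℝ)) ∧
    (∀ n : ℕ, ENNReal.ofReal (dpBound i j n) ≤ (gDP i j n : ENNReal)) ∧
    {n : ℕ | (gDP i j n : ENNReal) = ENNReal.ofReal (dpBound i j n)}.Infinite := by
  refine ⟨fun V _ G hG => hG.dpBound_le hi hj, ofReal_dpBound_le_gDP hi hj, ?_⟩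
  refine Set.infinite_of_injective_forall_mem
    (f := fun t : ℕ => (i + j + 2) * ((t + 1) * (i + 1) + 1) + 1) (fun s t hst => ?_) fun t => ?_
  · simp only [Nat.add_right_cancel_iff] at hst
    have h1 := Nat.eq_of_mul_eq_mul_left (by omega) hst
    have h2 := Nat.eq_of_mul_eq_mul_right (by omega) (Nat.add_right_cancel h1)
    omega
  · obtain ⟨G, hG, hcard⟩ := exists_isDPCritical hi hj (Nat.le_add_left 1 t)
    refine le_antisymm ?_ (ofReal_dpBound_le_gDP hi hj _)
    have h1 : gDP i j ((i + j + 2) * ((t + 1) * (i + 1) + 1) + 1) ≤ G.edgeSet.encard :=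
      iInf₂_le G hG
    refine (ENat.toENNReal_le.2 h1).trans (le_of_eq ?_)
    rw [← hcard, ← Set.Finite.cast_ncard_eq (Set.toFinite G.edgeSet), ENat.toENNReal_coe,
      ENNReal.ofReal_natCast]
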